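/- Let $(\Omega,\mathcal F,\mathbb P)$ be a complete probability space with two filtrations $\mathbb F\subset\mathbb G$, indexed by $[0,\infty)$ and satisfying the usual conditions. Let $X$ be a real-valued $\mathbb G$-semimartingale, $\chi(x)=x\mathbf 1_{\{|x|\le 1\}}$, and let $B^{\mathbb G}$ be the first $\mathbb G$-characteristic of $X$, i.e. the $\mathbb G$-predictable finite variation process with $B^{\mathbb G}_0=0$ such that $$X_t-X_0-\sum_{0<s\le t}\big(\Delta X_s-\chi(\Delta X_s)\big)-B^{\mathbb G}_t$$ is a $\mathbb G$-local martingale null at $0$. Suppose that $B^{\mathbb G}_t=\int_0^t b^{\mathbb G}_u\,dA^{\mathbb G}_u$ and $A^{\mathbb G}_t=\int_0^t a^{\mathbb G}_u\,du$, where $b^{\mathbb G}$ and the increasing process $A^{\mathbb G}$ are $\mathbb G$-predictable and $a^{\mathbb G}\ge 0$ is $\mathbb G$-progressively measurable. For a process $Z$, an optional projection ${}^{o,\mathbb F}Z$ of $Z$ on $\mathbb F$ is a real-valued process, measurable with respect to the $\sigma$-field on $[0,\infty)\times\Omega$ generated by the $\mathbb F$-adapted càdlàg processes, such that for every $\mathbb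 F$-stopping time $\tau$ the variable $Z_\tau\mathbf 1_{\{\tau<\infty\}}$ is $\sigma$-integrable with respect to $\mathcal F_\tau$ (there are $A_n\in\mathcal F_\tau$, $A_n\uparrow\Omega$, with $\mathbb E(|Z_\tau|\mathbf 1_{\{\tau<\infty\}}\mathbf 1_{A_n})<\infty$) and $$\mathbb E\big(Z_\tau\mathbf 1_{\{\tau<\infty\}}\,\big|\,\mathcal F_\tau\big)={}^{o,\mathbb F}Z_\tau\mathbf 1_{\{\tau<\infty\}}\quad\text{a.s.}$$ Assume: A1. $\mathbb E\big(\int_0^t|b^{\mathbb G}_u|\,a^{\mathbb G}_u\,du\big)<\infty$ for every $t\ge 0$. A2. The process $b^{\mathbb G}a^{\mathbb G}$ admits an optional projection on $\mathbb F$. Then $B^{\mathbb G}$ has an optional projection ${}^{o,\mathbb F}B^{\mathbb G}$ such that, for every version of ${}^{o,\mathbb F}(b^{\mathbb G}a^{\mathbb G})$, the following holds. The integrals $\int_0^t{}^{o,\mathbb F}(b^{\mathbb G}a^{\mathbb G})_u\,du$, $t\ge0$, exist and are finite almost surely, and $$M^B_t={}^{o,\mathbb F}B^{\mathbb G}_t-\int_0^t{}^{o,\mathbb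 F}(b^{\mathbb G}a^{\mathbb G})_u\,du,\qquad t\ge 0,$$ is an $\mathbb F$-martingale with almost surely càdlàg paths. If moreover $\mathbb F$ is $\mathbb P$-immersed in $\mathbb G$ (every $\mathbb F$-martingale is a $\mathbb G$-martingale), then almost surely $M^B_t=0$ for all $t\ge 0$. For any other version of ${}^{o,\mathbb F}B^{\mathbb G}$ the process $M^B$ is likewise an $\mathbb F$-martingale, and under immersion $M^B_\tau\mathbf 1_{\{\tau<\infty\}}=0$ a.s. for every $\mathbb F$-stopping time $\tau$. The process $X$ need not be $\mathbb F$-adapted. -/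

import Mathlib

open MeasureTheory ProbabilityTheory Filter Set
open scoped NNReal ENNReal Topology

namespace Shrinkage

noncomputable section

variable {Ω : Type*} {mΩ : MeasurableSpace Ω}

/-- The usual conditions: right-continuity, and every `P`-null set (hence also every subset of one)
belongs to the initial σ-algebra. In particular the probability space is complete. -/
structure UsualConditions (𝓕 : Filtration ℝ≥0 mΩ) (P : Measure Ω) : Prop where
  rightContinuous : 𝓕.IsRightContinuous
  null_mem : ∀ s : Set Ω, P s = 0 → MeasurableSet[𝓕 0] s

/-- Right-continuous with left limits. -/
def IsCadlag (f : ℝ≥0 → ℝ) : Prop :=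
  ∀ t, ContinuousWithinAt f (Ici t) t ∧ ∃ l, Tendsto f (𝓝[<] t) (𝓝 l)

/-- Lebesgue measure on the time axis `[0, ∞)`. -/
def leb : Measure ℝ≥0 := Measure.comap ((↑) : ℝ≥0 → ℝ) volume

/-! ### Optional projections -/

/-- The optional σ-algebra: generated by the adapted processes with càdlàg paths. -/
@[reducible]
def optional (𝓕 : Filtration ℝ≥0 mΩ) : MeasurableSpace (ℝ≥0 × Ω) :=
  ⨆ (Z : ℝ≥0 → Ω → ℝ) (_ : StronglyAdapted 𝓕 Z ∧ ∀ ω, IsCadlag fun t => Z t ω),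
    MeasurableSpace.comap (Function.uncurry Z) inferInstance

/-- `η` is the conditional expectation of `ξ` given `m`, for a random variable `ξ` that is
σ-integrable with respect to `m` (not necessarily integrable): there are sets `Aₙ ∈ m` increasing
to `Ω` such that `ξ 1_{Aₙ}` is integrable with `E(ξ 1_{Aₙ} | m) = η 1_{Aₙ}` almost surely. -/
def IsCondExp (m : MeasurableSpace Ω) {mΩ : MeasurableSpace Ω} (P : Measure Ω) (ξ η : Ω → ℝ) : Prop :=
  ∃ A : ℕ → Set Ω, Monotone A ∧ (∀ n, MeasurableSet[m] (A n)) ∧ (⋃ n, A n) = univ ∧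
    ∀ n, Integrable ((A n).indicator ξ) P ∧ P[(A n).indicator ξ | m] =ᵐ[P] (A n).indicator η

/-- The random variable `Z_τ 1_{τ < ∞}`. -/
def valueAt (Z : ℝ≥0 → Ω → ℝ) (τ : Ω → WithTop ℝ≥0) : Ω → ℝ :=
  {ω | τ ω < ⊤}.indicator (stoppedValue Z τ)

/-- `Y` is (a version of) the optional projection of `Z` on `𝓕`: it is optional, real valued, and
`E(Z_τ 1_{τ < ∞} | 𝓕_τ) = Y_τ 1_{τ < ∞}` for every stopping time `τ` of `𝓕`. -/
structure IsOptionalProjection (𝓕 : Filtration ℝ≥0 mΩ) (P : Measure Ω) (Z Y : ℝ≥0 → Ω → ℝ) :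
    Prop where
  measurable_optional : Measurable[optional 𝓕] (Function.uncurry Y)
  condExp_eq : ∀ (τ : Ω → WithTop ℝ≥0) (hτ : IsStoppingTime 𝓕 τ),
    IsCondExp hτ.measurableSpace P (valueAt Z τ) (valueAt Y τ)

/-- `𝓕` is `P`-immersed in `𝓖`: every `𝓕`-martingale is a `𝓖`-martingale. -/
def Immersed (𝓕 𝓖 : Filtration ℝ≥0 mΩ) (P : Measure Ω) : Prop :=
  ∀ N : ℝ≥0 → Ω → ℝ, Martingale N 𝓕 P → Martingale N 𝓖 P

/-! ### Semimartingales and their first characteristic -/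

/-- Local martingales null at `0`. -/
structure IsLocalMartingaleNull (𝓖 : Filtration ℝ≥0 mΩ) (P : Measure Ω) (M : ℝ≥0 → Ω → ℝ) :
    Prop where
  adapted : StronglyAdapted 𝓖 M
  cadlag : ∀ ω, IsCadlag fun t => M t ω
  zero : ∀ ω, M 0 ω = 0
  locally_martingale : Locally (fun N => Martingale N 𝓖 P) 𝓖 M P

/-- Adapted càdlàg processes null at `0` whose paths have finite variation on compacts. -/
structure IsFiniteVariationNull (𝓖 : Filtration ℝ≥0 mΩ) (V : ℝ≥0 → Ω → ℝ) : Prop where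
  adapted : StronglyAdapted 𝓖 V
  cadlag : ∀ ω, IsCadlag fun t => V t ω
  zero : ∀ ω, V 0 ω = 0
  finite_variation : ∀ ω, LocallyBoundedVariationOn (fun t => V t ω) univ

/-- Semimartingales: `X = X₀ + M + V` with a local martingale `M` and a process `V` of finite
variation. -/
structure IsSemimartingale (𝓖 : Filtration ℝ≥0 mΩ) (P : Measure Ω) (X : ℝ≥0 → Ω → ℝ) :
    Prop where
  adapted : StronglyAdapted 𝓖 X
  cadlag : ∀ ω, IsCadlag fun t => X t ω
  decomposition : ∃ M V : ℝ≥0 → Ω → ℝ, IsLocalMartingaleNull 𝓖 P M ∧ IsFiniteVariationNull 𝓖 V ∧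
    ∀ᵐ ω ∂P, ∀ t, X t ω = X 0 ω + M t ω + V t ω

/-- The standard truncation function `χ(x) = x 1_{|x| ≤ 1}`. -/
def trunc (x : ℝ) : ℝ := if |x| ≤ 1 then x else 0

/-- The jump `f(t) - f(t-)`. -/
def jump (f : ℝ≥0 → ℝ) (t : ℝ≥0) : ℝ := f t - Function.leftLim f t

/-- `X(χ)_t = X_t - X_0 - ∑_{0 < s ≤ t} (ΔX_s - χ(ΔX_s))`. Along a càdlàg path only finitely many
terms of the sum are nonzero. -/
def truncatedProcess (X : ℝ≥0 → Ω → ℝ) : ℝ≥0 → Ω → ℝ := fun t ω =>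
  X t ω - X 0 ω -
    ∑ᶠ s ∈ Ioc 0 t, (jump (fun r => X r ω) s - trunc (jump (fun r => X r ω) s))

/-- `B` is (a version of) the first characteristic of `X`: the predictable finite variation part
in the canonical decomposition `X(χ) = B + M`. -/
structure IsFirstCharacteristic (𝓖 : Filtration ℝ≥0 mΩ) (P : Measure Ω) (X B : ℝ≥0 → Ω → ℝ) :
    Prop where
  predictable : IsStronglyPredictable 𝓖 B
  finiteVariation : IsFiniteVariationNull 𝓖 B
  localMartingale : IsLocalMartingaleNull 𝓖 P fun t ω => truncatedProcess X t ω - B t ω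

/-- `g(t) = ∫_{(0,t]} f(u) dα(u)` for all `t`, a Lebesgue–Stieltjes integral against an increasing
right-continuous function `α`. -/
def IsStieltjesIntegral (f α g : ℝ≥0 → ℝ) : Prop :=
  ∃ S : StieltjesFunction ℝ≥0, (∀ t, S t = α t) ∧
    ∀ t, IntegrableOn f (Ioc 0 t) S.measure ∧ g t = ∫ u in Ioc 0 t, f u ∂S.measure

/-- The increasing process `A` is predictable and absolutely continuous with progressively
measurable density `a ≥ 0`, and `B = b · A` with `b` predictable. -/
structure HasDifferential (𝓖 : Filtration ℝ≥0 mΩ) (P : Measure Ω) (B A b a : ℝ≥0 → Ω → ℝ) :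
    Prop where
  predictable_A : IsStronglyPredictable 𝓖 A
  predictable_b : IsStronglyPredictable 𝓖 b
  progressive_a : IsStronglyProgressive 𝓖 a
  nonneg_a : ∀ t ω, 0 ≤ a t ω
  A_eq : ∀ᵐ ω ∂P, ∀ t, IntegrableOn (fun u => a u ω) (Ioc 0 t) leb ∧
    A t ω = ∫ u in Ioc 0 t, a u ω ∂leb
  B_eq : ∀ᵐ ω ∂P, IsStieltjesIntegral (fun u => b u ω) (fun u => A u ω) (fun u => B u ω)

/-- The process `M^B_t = Y_t - ∫_0^t K_u du`. -/
def subIntegral (Y K : ℝ≥0 → Ω → ℝ) : ℝ≥0 → Ω → ℝ := fun t ω =>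
  Y t ω - ∫ u in Ioc 0 t, K u ω ∂leb

end

end Shrinkage

open Shrinkage

/-! Write `k` for the product of `b` and `a`. Passing from the Stieltjes measure to its density
gives B_t = ∫_0^t k_u du almost surely, with `k` progressive for `G`. If `H` is an optional
projection of `k`, then H_u = E(k_u | F_u) for almost every u. Conditional Jensen and A1 make `H`
integrable on [0,t] × Ω, so I_t = ∫_0^t H_u du is a continuous `F`-adapted process.

Put J = k - H and D = B - I = ∫ J du. Since E(J_u | F_u) = 0 for almost every u, Fubini yields E(D_N
- D_τ | F_τ) = 0 for each `F`-stopping time τ ≤ N: a set of F_τ intersected with {τ < u} belongs to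
F_u (`condExp_stoppedValue_of_drift`). For constant τ this says that E(D_t | F_t) is an
`F`-martingale. It has a càdlàg modification M, by Doob's upcrossing and maximal inequalities along
dyadic grids (`exists_cadlag_modification`). Optional sampling for M gives M_τ = E(D_τ | F_τ), so M
+ I is an optional projection of `B` (`exists_optionalProjection_of_drift`). Unbounded τ are reached
through σ-integrability.

Under immersion, k_u has the same conditional expectation given F_t as given F_u for u ≤ t. Hence
E(D_t | F_t) = 0, and the càdlàg process M vanishes. Two versions of `H` agree almost surely at each
fixed time and therefore have indistinguishable integrals; two projections of `B` agree almost
surely at each stopping time. -/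

namespace Shrinkage

/-! ### Dyadic times -/

/-- The nonnegative dyadic rationals. -/
def dyadics : Set ℝ≥0 := {x | ∃ m i : ℕ, x = i / 2 ^ m}

/-- The smallest multiple of `2⁻ⁿ` that is strictly larger than `t`. -/
noncomputable def dyadicAbove (n : ℕ) (t : ℝ≥0) : ℝ≥0 := ((⌊t * 2 ^ n⌋₊ + 1 : ℕ) : ℝ≥0) / 2 ^ n

lemma dyadicAbove_mem (n : ℕ) (t : ℝ≥0) : dyadicAbove n t ∈ dyadics := ⟨n, _, rfl⟩

lemma lt_dyadicAbove (n : ℕ) (t : ℝ≥0) : t < dyadicAbove n t := by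
  rw [dyadicAbove, lt_div_iff₀ (by positivity)]
  exact_mod_cast Nat.lt_floor_add_one (t * 2 ^ n)

lemma dyadicAbove_le_add (n : ℕ) (t : ℝ≥0) : dyadicAbove n t ≤ t + (1 / 2) ^ n := by
  rw [dyadicAbove, div_le_iff₀ (by positivity), add_mul, ← mul_pow]
  norm_num
  exact Nat.floor_le (by positivity)

lemma tendsto_dyadicAbove (t : ℝ≥0) : Tendsto (fun n => dyadicAbove n t) atTop (𝓝 t) := by
  have h : Tendsto (fun n : ℕ => t + (1 / 2 : ℝ≥0) ^ n) atTop (𝓝 (t + 0)) :=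
    tendsto_const_nhds.add (NNReal.tendsto_pow_atTop_nhds_zero_of_lt_one (by
      rw [div_lt_one (by norm_num)]; norm_num))
  rw [add_zero] at h
  exact tendsto_of_tendsto_of_tendsto_of_le_of_le tendsto_const_nhds h
    (fun n => (lt_dyadicAbove n t).le) (fun n => dyadicAbove_le_add n t)

lemma tendsto_dyadicAbove_nhdsWithin (t : ℝ≥0) :
    Tendsto (fun n => dyadicAbove n t) atTop (𝓝[Ioi t ∩ dyadics] t) :=
  tendsto_nhdsWithin_iff.2 ⟨tendsto_dyadicAbove t,
    Eventually.of_forall fun n => ⟨lt_dyadicAbove n t, dyadicAbove_mem n t⟩⟩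

/-- The strict inequality on the right makes the dyadic approximation of a stopping time a stopping
time: the event is decided at the last grid point not after `i`. -/
lemma dyadicAbove_le_iff (n : ℕ) (t i : ℝ≥0) :
    dyadicAbove n t ≤ i ↔ t < (⌊i * 2 ^ n⌋₊ : ℝ≥0) / 2 ^ n := by
  rw [dyadicAbove, div_le_iff₀ (by positivity), lt_div_iff₀ (by positivity),
    ← Nat.le_floor_iff (by positivity), Nat.succ_le_iff, Nat.floor_lt (by positivity)]

lemma floor_dyadic_le (n : ℕ) (i : ℝ≥0) : (⌊i * 2 ^ n⌋₊ : ℝ≥0) / 2 ^ n ≤ i := by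
  rw [div_le_iff₀ (by positivity)]
  exact Nat.floor_le (by positivity)

lemma eventually_dyadic_index {x : ℝ≥0} (hx : x ∈ dyadics) :
    ∀ᶠ m : ℕ in atTop, ∃ i : ℕ, x * 2 ^ m = i := by
  obtain ⟨m₀, i, rfl⟩ := hx
  filter_upwards [eventually_ge_atTop m₀] with m hm
  obtain ⟨d, rfl⟩ := Nat.exists_eq_add_of_le hm
  refine ⟨i * 2 ^ d, ?_⟩
  push_cast
  rw [pow_add]
  field_simp

instance nhdsWithin_Ioi_inter_dyadics_neBot (t : ℝ≥0) : (𝓝[Ioi t ∩ dyadics] t).NeBot :=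
  (tendsto_dyadicAbove_nhdsWithin t).neBot

/-! ### Upcrossings along dyadic grids -/

section Upcrossings

/-- The number of upcrossings of `[a, b]` made by `g` along `2⁻ᵐ ℕ` strictly before time `t`. -/
noncomputable def gridUpcrossings (a b : ℝ) (g : ℝ≥0 → ℝ) (m : ℕ) (t : ℝ≥0) : ℕ :=
  upcrossingsBefore a b (fun (i : ℕ) (_ : Unit) => g (i / 2 ^ m)) ⌈t * 2 ^ m⌉₊ ()

variable {a b : ℝ} {g : ℝ≥0 → ℝ}

lemma gridUpcrossings_mono (hab : a < b) (m : ℕ) : Monotone (gridUpcrossings a b g m) := by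
  intro s t hst
  exact upcrossingsBefore_mono hab (Nat.ceil_mono (by gcongr)) ()

/-- Every sufficiently fine grid contains both dyadics `s` and `r`, and there the passage from below
`a` to above `b` completes an additional upcrossing. -/
lemma eventually_gridUpcrossings_lt (hab : a < b) {x s r y : ℝ≥0} (hxs : x ≤ s) (hsr : s ≤ r)
    (hry : r < y) (hs : s ∈ dyadics) (hr : r ∈ dyadics) (hsa : g s < a) (hbr : b < g r) :
    ∀ᶠ m in atTop, gridUpcrossings a b g m x + 1 ≤ gridUpcrossings a b g m y := by
  filter_upwards [eventually_dyadic_index hs, eventually_dyadic_index hr] with m ⟨i, hi⟩ ⟨j, hj⟩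
  have hi' : (i : ℝ≥0) / 2 ^ m = s := by rw [← hi]; field_simp
  have hj' : (j : ℝ≥0) / 2 ^ m = r := by rw [← hj]; field_simp
  have h1 : ⌈x * 2 ^ m⌉₊ ≤ i := by
    rw [Nat.ceil_le, ← hi]; gcongr
  have h2 : i ≤ j := by
    have : (i : ℝ≥0) ≤ j := by rw [← hi, ← hj]; gcongr
    exact_mod_cast this
  have h3 : j + 1 ≤ ⌈y * 2 ^ m⌉₊ := by
    rw [Nat.succ_le_iff, Nat.lt_ceil, ← hj]; gcongr
  refine Nat.succ_le_of_lt (lt_of_lt_of_le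
    (upcrossingsBefore_lt_of_exists_upcrossing (f := fun (i : ℕ) (_ : Unit) => g (i / 2 ^ m))
      (ω := ()) hab h1 (by simpa only [hi'] using hsa) h2 (by simpa only [hj'] using hbr))
    (upcrossingsBefore_mono hab h3 ()))

/-- Upcrossings are collected backwards towards `t`: choose the high point `r` first, then a low
point `s` in (t, r), and use the induction hypothesis on [t, s]. -/
lemma eventually_gridUpcrossings_of_frequently_right (hab : a < b) {t : ℝ≥0}
    (ha : ∃ᶠ s in 𝓝[Ioi t ∩ dyadics] t, g s < a) (hb : ∃ᶠ s in 𝓝[Ioi t ∩ dyadics] t, b < g s)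
    (K : ℕ) : ∀ y > t, ∀ᶠ m in atTop, gridUpcrossings a b g m t + K ≤ gridUpcrossings a b g m y := by
  have key : ∀ y > t, ∀ᶠ s in 𝓝[Ioi t ∩ dyadics] t, s < y ∧ s ∈ Ioi t ∩ dyadics := fun y hy =>
    (eventually_nhdsWithin_of_eventually_nhds (eventually_lt_nhds hy)).and self_mem_nhdsWithin
  induction K with
  | zero =>
    intro y hy
    filter_upwards with m using gridUpcrossings_mono hab m hy.le
  | succ K ih =>
    intro y hy
    obtain ⟨r, hr, hry, htr, hrD⟩ := (hb.and_eventually (key y hy)).exists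
    obtain ⟨s, hs, hsr, hts, hsD⟩ := (ha.and_eventually (key r htr)).exists
    filter_upwards [ih s hts, eventually_gridUpcrossings_lt hab le_rfl hsr.le hry hsD hrD hs hr]
      with m h1 h2
    lia

lemma eventually_gridUpcrossings_of_frequently_left (hab : a < b) {t : ℝ≥0}
    (ha : ∃ᶠ s in 𝓝[Iio t ∩ dyadics] t, g s < a) (hb : ∃ᶠ s in 𝓝[Iio t ∩ dyadics] t, b < g s)
    (K : ℕ) : ∀ x < t, ∀ᶠ m in atTop, gridUpcrossings a b g m x + K ≤ gridUpcrossings a b g m t := by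
  have key : ∀ x < t, ∀ᶠ s in 𝓝[Iio t ∩ dyadics] t, x < s ∧ s ∈ Iio t ∩ dyadics := fun y hy =>
    (eventually_nhdsWithin_of_eventually_nhds (eventually_gt_nhds hy)).and self_mem_nhdsWithin
  induction K with
  | zero =>
    intro x hx
    filter_upwards with m using gridUpcrossings_mono hab m hx.le
  | succ K ih =>
    intro x hx
    obtain ⟨s, hs, hxs, hst, hsD⟩ := (ha.and_eventually (key x hx)).exists
    obtain ⟨r, hr, hsr, hrt, hrD⟩ := (hb.and_eventually (key s hst)).exists
    obtain ⟨y, hry, hyt⟩ := exists_between (mem_Iio.1 hrt)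
    filter_upwards [ih y hyt, eventually_gridUpcrossings_lt hab hxs.le hsr.le hry hsD hrD hs hr]
      with m h1 h2
    lia

/-- A function that is bounded along the dyadics of bounded intervals and whose numbers of
upcrossings along dyadic grids do not tend to infinity has one-sided limits along the dyadics. -/
lemma exists_dyadic_limits (hbdd : ∀ N : ℕ, ∃ C, ∀ s ∈ dyadics, s ≤ N → |g s| ≤ C)
    (hup : ∀ (N : ℕ) (a b : ℚ), a < b →
      liminf (fun m => (gridUpcrossings a b g m N : ℝ≥0∞)) atTop < ∞) (t : ℝ≥0) :
    (∃ c, Tendsto g (𝓝[Ioi t ∩ dyadics] t) (𝓝 c)) ∧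
      ∃ c, Tendsto g (𝓝[Iio t ∩ dyadics] t) (𝓝 c) := by
  obtain ⟨N, hN⟩ := exists_nat_gt t
  obtain ⟨C, hC⟩ := hbdd N
  have hbd : ∀ S : Set ℝ≥0, ∀ᶠ s in 𝓝[S ∩ dyadics] t, |g s| ≤ C := by
    intro S
    filter_upwards [eventually_nhdsWithin_of_eventually_nhds (eventually_lt_nhds hN),
      self_mem_nhdsWithin] with s hs hsD using hC s hsD.2 hs.le
  have hno : ∀ (a b : ℚ), a < b → ¬ ∀ K : ℕ, ∀ᶠ m in atTop, K ≤ gridUpcrossings a b g m N := by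
    intro a b hab h
    refine (hup N a b hab).ne ?_
    refine Tendsto.liminf_eq ?_
    rw [ENNReal.tendsto_nhds_top_iff_nat]
    intro K
    filter_upwards [h (K + 1)] with m hm
    exact_mod_cast hm
  have main : ∀ S : Set ℝ≥0, (∀ a b : ℚ, a < b →
      ¬((∃ᶠ s in 𝓝[S ∩ dyadics] t, g s < a) ∧ ∃ᶠ s in 𝓝[S ∩ dyadics] t, (b : ℝ) < g s)) →
      ∃ c, Tendsto g (𝓝[S ∩ dyadics] t) (𝓝 c) := by
    intro S hS
    refine tendsto_of_no_upcrossings (s := range ((↑) : ℚ → ℝ)) Rat.denseRange_cast ?_ ?_ ?_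
    · rintro _ ⟨a, rfl⟩ _ ⟨b, rfl⟩ hab
      exact hS a b (by exact_mod_cast hab)
    · exact ⟨C, eventually_map.2 ((hbd S).mono fun s hs => (abs_le.1 hs).2)⟩
    · exact ⟨-C, eventually_map.2 ((hbd S).mono fun s hs => (abs_le.1 hs).1)⟩
  refine ⟨main _ ?_, main _ ?_⟩
  · rintro a b hab ⟨ha, hb⟩
    refine hno a b hab fun K => ?_
    filter_upwards [eventually_gridUpcrossings_of_frequently_right (by exact_mod_cast hab) ha hb K
      N hN] with m hm using le_of_add_le_right hm
  · rintro a b hab ⟨ha, hb⟩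
    refine hno a b hab fun K => ?_
    have h0 : 0 < t := by
      rcases eq_zero_or_pos t with rfl | h
      · simp at ha
      · exact h
    filter_upwards [eventually_gridUpcrossings_of_frequently_left (by exact_mod_cast hab) ha hb K
      0 h0] with m hm
    exact (le_of_add_le_right hm).trans
      (gridUpcrossings_mono (by exact_mod_cast hab) m hN.le)

end Upcrossings

/-- The right limits along the dyadics of a function with one-sided limits along the dyadics
form a càdlàg function. -/
lemma isCadlag_of_dyadic_limits {g h : ℝ≥0 → ℝ}
    (hr : ∀ t, Tendsto g (𝓝[Ioi t ∩ dyadics] t) (𝓝 (h t)))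
    (hl : ∀ t, ∃ c, Tendsto g (𝓝[Iio t ∩ dyadics] t) (𝓝 c)) : IsCadlag h := by
  have key : ∀ (s : ℝ≥0) (V : Set ℝ) (U : Set ℝ≥0), IsClosed V → U ∈ 𝓝 s →
      (∀ r ∈ U, s < r → r ∈ dyadics → g r ∈ V) → h s ∈ V := by
    intro s V U hV hU hUV
    refine hV.mem_of_tendsto (hr s) ?_
    filter_upwards [mem_nhdsWithin_of_mem_nhds hU, self_mem_nhdsWithin] with r hr hr'
      using hUV r hr hr'.1 hr'.2
  intro t
  constructor
  · rw [ContinuousWithinAt, (closed_nhds_basis (h t)).tendsto_right_iff]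
    rintro V ⟨hVn, hV⟩
    have := (hr t) hVn
    rw [mem_map, mem_nhdsWithin] at this
    obtain ⟨U, hUo, htU, hUV⟩ := this
    filter_upwards [mem_nhdsWithin_of_mem_nhds (hUo.mem_nhds htU), self_mem_nhdsWithin] with s hs hts
    exact key s V U hV (hUo.mem_nhds hs) fun r hrU hsr hrD => hUV ⟨hrU, lt_of_le_of_lt hts hsr, hrD⟩
  · obtain ⟨c, hc⟩ := hl t
    refine ⟨c, ?_⟩
    rw [(closed_nhds_basis c).tendsto_right_iff]
    rintro V ⟨hVn, hV⟩
    have := hc hVn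
    rw [mem_map, mem_nhdsWithin] at this
    obtain ⟨U, hUo, htU, hUV⟩ := this
    filter_upwards [mem_nhdsWithin_of_mem_nhds (hUo.mem_nhds htU), self_mem_nhdsWithin] with s hs hts
    exact key s V (U ∩ Iio t) hV (inter_mem (hUo.mem_nhds hs) (Iio_mem_nhds hts))
      fun r hrU hsr hrD => hUV ⟨hrU.1, hrU.2, hrD⟩

variable {Ω : Type*} {mΩ : MeasurableSpace Ω} {P : Measure Ω} {F G : Filtration ℝ≥0 mΩ}
  {M : ℝ≥0 → Ω → ℝ}

/-! ### Regularization of martingales -/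

/-- The restriction of a filtration to the grid `2⁻ᵐ ℕ`. -/
noncomputable def gridFiltration (F : Filtration ℝ≥0 mΩ) (m : ℕ) : Filtration ℕ mΩ where
  seq i := F (i / 2 ^ m)
  mono' i j hij := F.mono (by gcongr)
  le' i := F.le _

lemma martingale_grid (hM : Martingale M F P) (m : ℕ) :
    Martingale (fun i : ℕ => M (i / 2 ^ m)) (gridFiltration F m) P :=
  ⟨fun _ => hM.1 _, fun i j hij => hM.2 _ _ (by gcongr)⟩

/-- Crossing times depend on one path only. This links the deterministic count, defined over `Unit`,
with Doob's inequality on Ω. -/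
lemma upperCrossingTime_eq_path (a b : ℝ) (f : ℕ → Ω → ℝ) (N : ℕ) (ω : Ω) (n : ℕ) :
    upperCrossingTime a b f N n ω = upperCrossingTime a b (fun i (_ : Unit) => f i ω) N n () := by
  induction n with
  | zero => rfl
  | succ n ih =>
    rw [upperCrossingTime_succ, upperCrossingTime_succ, ih]
    rfl

lemma gridUpcrossings_path (a b : ℝ) (M : ℝ≥0 → Ω → ℝ) (m : ℕ) (t : ℝ≥0) (ω : Ω) :
    gridUpcrossings a b (fun s => M s ω) m t =
      upcrossingsBefore a b (fun (i : ℕ) => M (i / 2 ^ m)) ⌈t * 2 ^ m⌉₊ ω := by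
  simp only [gridUpcrossings, upcrossingsBefore, upperCrossingTime_eq_path (Ω := Ω)]

lemma natCast_mul_pow_div (N m : ℕ) : ((⌈(N : ℝ≥0) * 2 ^ m⌉₊ : ℕ) : ℝ≥0) / 2 ^ m = N := by
  have : (N : ℝ≥0) * 2 ^ m = ((N * 2 ^ m : ℕ) : ℝ≥0) := by push_cast; rfl
  rw [this, Nat.ceil_natCast]
  push_cast
  field_simp

/-- Every grid contains the integer `N`, so Doob's upcrossing bound involves only M_N and is uniform
in the mesh. Fatou's lemma then applies. -/
lemma ae_liminf_gridUpcrossings_lt_top [IsFiniteMeasure P] (hM : Martingale M F P) {a b : ℝ}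
    (hab : a < b) (N : ℕ) : ∀ᵐ ω ∂P,
      liminf (fun m => (gridUpcrossings a b (fun s => M s ω) m N : ℝ≥0∞)) atTop < ∞ := by
  have hmeas : ∀ m, Measurable fun ω => (gridUpcrossings a b (fun s => M s ω) m N : ℝ≥0∞) := by
    intro m
    simp only [gridUpcrossings_path]
    exact measurable_from_top.comp
      ((martingale_grid hM m).stronglyAdapted.measurable_upcrossingsBefore hab)
  have hbound : ∀ m, ∫⁻ ω, (gridUpcrossings a b (fun s => M s ω) m N : ℝ≥0∞) ∂P ≤
      ENNReal.ofReal ((∫ ω, (M N ω - a)⁺ ∂P) / (b - a)) := by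
    intro m
    have h := (martingale_grid hM m).submartingale.mul_integral_upcrossingsBefore_le_integral_pos_part
      a b ⌈(N : ℝ≥0) * 2 ^ m⌉₊
    have h_int := (martingale_grid hM m).stronglyAdapted.integrable_upcrossingsBefore (μ := P)
      (N := ⌈(N : ℝ≥0) * 2 ^ m⌉₊) hab
    rw [natCast_mul_pow_div] at h
    rw [← le_div_iff₀' (sub_pos.2 hab)] at h
    refine le_trans (le_of_eq ?_) (ENNReal.ofReal_le_ofReal h)
    rw [ofReal_integral_eq_lintegral_ofReal h_int (Eventually.of_forall fun ω => by positivity)]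
    simp only [gridUpcrossings_path, ENNReal.ofReal_natCast]
  refine ae_lt_top (.liminf hmeas) (ne_top_of_le_ne_top ENNReal.ofReal_ne_top
    (b := ENNReal.ofReal ((∫ ω, (M N ω - a)⁺ ∂P) / (b - a))) ?_)
  refine (lintegral_liminf_le hmeas).trans ?_
  refine (liminf_le_liminf (Eventually.of_forall hbound)).trans ?_
  simp

/-- Doob's maximal inequality for |M| on each grid, uniform in the mesh. The grids are nested, so
the bound c · P(sup ≥ c) ≤ E|M_N| passes to all dyadics. -/
lemma ae_bounded_dyadics [IsFiniteMeasure P] (hM : Martingale M F P) (N : ℕ) :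
    ∀ᵐ ω ∂P, ∃ C, ∀ s ∈ dyadics, s ≤ N → |M s ω| ≤ C := by
  set R : ℝ := ∫ ω, |M N ω| ∂P with hR
  let E : ℕ → ℕ → Set Ω := fun c m => {ω | ∃ i : ℕ, i ≤ N * 2 ^ m ∧ (c : ℝ) ≤ |M (i / 2 ^ m) ω|}
  have hEmono : ∀ c, Monotone (E c) := by
    intro c
    refine monotone_nat_of_le_succ fun m => ?_
    rintro ω ⟨i, hi, hc⟩
    refine ⟨i * 2, by rw [pow_succ]; lia, ?_⟩
    have : ((i * 2 : ℕ) : ℝ≥0) / 2 ^ (m + 1) = i / 2 ^ m := by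
      push_cast; rw [pow_succ]; field_simp
    rwa [this]
  have hE : ∀ c m : ℕ, (c : ℝ≥0∞) * P (E c m) ≤ ENNReal.ofReal R := by
    intro c m
    have hsub : Submartingale (fun i : ℕ => M (i / 2 ^ m) ⊔ - M (i / 2 ^ m))
        (gridFiltration F m) P :=
      (martingale_grid hM m).submartingale.sup (martingale_grid hM m).neg.submartingale
    have hmax := maximal_ineq (ε := (c : ℝ≥0)) hsub (fun i ω => abs_nonneg (M (i / 2 ^ m) ω))
      (N * 2 ^ m)
    have hset : E c m = {ω | ((c : ℝ≥0) : ℝ) ≤ (Finset.range (N * 2 ^ m + 1)).sup'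
        Finset.nonempty_range_add_one fun k => (M (k / 2 ^ m) ⊔ - M (k / 2 ^ m)) ω} := by
      ext ω
      simp only [E, mem_ofPred_eq, Finset.le_sup'_iff, Finset.mem_range, Nat.lt_succ_iff,
        NNReal.coe_natCast]
      rfl
    rw [← hset] at hmax
    refine hmax.trans (ENNReal.ofReal_le_ofReal ?_)
    have hN : (((N * 2 ^ m : ℕ) : ℝ≥0)) / 2 ^ m = N := by push_cast; field_simp
    rw [hN]
    exact setIntegral_le_integral (hM.integrable N).abs
      (Eventually.of_forall fun ω => abs_nonneg _)
  have hEU : ∀ c : ℕ, (c : ℝ≥0∞) * P (⋃ m, E c m) ≤ ENNReal.ofReal R := by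
    intro c
    rw [(hEmono c).measure_iUnion, ENNReal.mul_iSup]
    exact iSup_le (hE c)
  have hnull : P (⋂ c, ⋃ m, E c m) = 0 := by
    by_contra h0
    have h1 : ∀ c : ℕ, (c : ℝ≥0∞) * P (⋂ c, ⋃ m, E c m) ≤ ENNReal.ofReal R := fun c =>
      le_trans (by gcongr; exact iInter_subset _ c) (hEU c)
    have h2 : Tendsto (fun c : ℕ => (c : ℝ≥0∞) * P (⋂ c, ⋃ m, E c m)) atTop (𝓝 ∞) := by
      have := ENNReal.Tendsto.mul_const (b := P (⋂ c, ⋃ m, E c m)) ENNReal.tendsto_nat_nhds_top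
        (Or.inl (by simp))
      rwa [ENNReal.top_mul h0] at this
    exact absurd (le_of_tendsto' h2 h1) (by simp)
  have : ∀ᵐ ω ∂P, ω ∉ ⋂ c, ⋃ m, E c m := measure_eq_zero_iff_ae_notMem.1 hnull
  filter_upwards [this] with ω hω
  simp only [mem_iInter, mem_iUnion, not_forall, not_exists, E, mem_ofPred_eq, not_and, not_le] at hω
  obtain ⟨c, hc⟩ := hω
  refine ⟨c, ?_⟩
  rintro s ⟨m, i, rfl⟩ hs
  refine (hc m i ?_).le
  rw [div_le_iff₀ (by positivity)] at hs
  exact_mod_cast hs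

/-- Almost every path of a martingale has one-sided limits along the dyadics. -/
lemma ae_exists_dyadic_limits [IsFiniteMeasure P] (hM : Martingale M F P) :
    ∀ᵐ ω ∂P, ∀ t, (∃ c, Tendsto (fun s => M s ω) (𝓝[Ioi t ∩ dyadics] t) (𝓝 c)) ∧
      ∃ c, Tendsto (fun s => M s ω) (𝓝[Iio t ∩ dyadics] t) (𝓝 c) := by
  have h1 := ae_all_iff.2 (ae_bounded_dyadics hM)
  have h2 : ∀ᵐ ω ∂P, ∀ (N : ℕ) (a b : ℚ), a < b →
      liminf (fun m => (gridUpcrossings a b (fun s => M s ω) m N : ℝ≥0∞)) atTop < ∞ := by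
    simp only [ae_all_iff]
    exact fun N a b hab => ae_liminf_gridUpcrossings_lt_top hM (by exact_mod_cast hab) N
  filter_upwards [h1, h2] with ω hω1 hω2 t using exists_dyadic_limits hω1 hω2 t

/-- If a uniformly integrable sequence converges almost surely and all its members have the same
conditional expectation given `m`, then so does the limit. -/
lemma condExp_of_tendsto_of_unifIntegrable [IsFiniteMeasure P] {m : MeasurableSpace Ω}
    {X : ℕ → Ω → ℝ} {Y Z : Ω → ℝ} (hX : UniformIntegrable X 1 P)
    (hlim : ∀ᵐ ω ∂P, Tendsto (fun n => X n ω) atTop (𝓝 (Y ω)))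
    (hZ : ∀ n, P[X n | m] =ᵐ[P] Z) : Integrable Y P ∧ P[Y | m] =ᵐ[P] Z := by
  obtain ⟨hXm, hXu, C, hC⟩ := hX
  have hYm : AEStronglyMeasurable[mΩ] Y P := aestronglyMeasurable_of_tendsto_ae _ hXm hlim
  have hY : MemLp Y 1 P := by
    refine ⟨hYm, lt_of_le_of_lt (Lp.eLpNorm_lim_le_liminf_eLpNorm hXm Y hlim) ?_⟩
    refine lt_of_le_of_lt (liminf_le_liminf (Eventually.of_forall hC)) ?_
    simp
  have hYi : Integrable Y P := memLp_one_iff_integrable.1 hY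
  have hXi : ∀ n, Integrable (X n) P := fun n =>
    memLp_one_iff_integrable.1 ⟨hXm n, (hC n).trans_lt ENNReal.coe_lt_top⟩
  have hL1 := tendsto_Lp_finite_of_tendsto_ae le_rfl ENNReal.one_ne_top hXm hY hXu hlim
  refine ⟨hYi, ?_⟩
  have hle : ∀ n, eLpNorm (Z - P[Y | m]) 1 P ≤ eLpNorm (X n - Y) 1 P := by
    intro n
    refine le_trans (le_of_eq ?_) (eLpNorm_condExp_le_eLpNorm (m := m) (X n - Y) le_rfl)
    exact eLpNorm_congr_ae ((hZ n).symm.sub EventuallyEq.rfl |>.trans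
      (condExp_sub (hXi n) hYi m).symm)
  have h0 : eLpNorm (Z - P[Y | m]) 1 P = 0 := le_antisymm (ge_of_tendsto' hL1 hle) bot_le
  have hZm : AEStronglyMeasurable[mΩ] Z P := integrable_condExp.aestronglyMeasurable.congr (hZ 0)
  rw [eLpNorm_eq_zero_iff (hZm.sub integrable_condExp.aestronglyMeasurable) one_ne_zero] at h0
  filter_upwards [h0] with ω hω
  simpa [sub_eq_zero, eq_comm] using hω

lemma uniformIntegrable_of_martingale [IsFiniteMeasure P] (hM : Martingale M F P) {N : ℝ≥0}
    {s : ℕ → ℝ≥0} (hs : ∀ n, s n ≤ N) : UniformIntegrable (fun n => M (s n)) 1 P :=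
  ((hM.integrable N).uniformIntegrable_condExp fun n => F.le (s n)).ae_eq
    fun n => hM.2 (s n) N (hs n)

lemma stronglyMeasurable_of_forall_gt [F.IsRightContinuous] {t : ℝ≥0} {f : Ω → ℝ}
    (h : ∀ s > t, StronglyMeasurable[F s] f) : StronglyMeasurable[F t] f := by
  refine Measurable.stronglyMeasurable fun A hA => ?_
  refine Filtration.IsRightContinuous.measurableSet ?_
  rw [Filtration.rightCont_eq]
  simp only [MeasurableSpace.measurableSet_iInf]
  exact fun s hs => (h s hs).measurable hA

lemma UsualConditions.measurableSet_of_ae (hF : UsualConditions F P) {s : Set Ω}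
    (hs : ∀ᵐ ω ∂P, ω ∈ s) (t : ℝ≥0) : MeasurableSet[F t] s := by
  rw [← compl_compl s]
  exact (F.mono (zero_le : (0 : ℝ≥0) ≤ t) _ (hF.null_mem _ hs)).compl

/-- Under the usual conditions every martingale has a modification with càdlàg paths. -/
theorem exists_cadlag_modification [IsFiniteMeasure P] (hF : UsualConditions F P)
    (hM : Martingale M F P) : ∃ N : ℝ≥0 → Ω → ℝ, StronglyAdapted F N ∧
      (∀ ω, IsCadlag fun t => N t ω) ∧ ∀ t, N t =ᵐ[P] M t := by
  classical
  have := hF.rightContinuous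
  -- This set depends on whole paths, but it has full measure, so the usual conditions put it in
  -- every F_t and restricting to it preserves adaptedness.
  set good : Set Ω := {ω | ∀ t, (∃ c, Tendsto (fun s => M s ω) (𝓝[Ioi t ∩ dyadics] t) (𝓝 c)) ∧
      ∃ c, Tendsto (fun s => M s ω) (𝓝[Iio t ∩ dyadics] t) (𝓝 c)} with hgood
  have hae : ∀ᵐ ω ∂P, ω ∈ good := ae_exists_dyadic_limits hM
  have hex : ∀ t ω, ∃ c, ω ∈ good → Tendsto (fun s => M s ω) (𝓝[Ioi t ∩ dyadics] t) (𝓝 c) := by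
    intro t ω
    by_cases h : ω ∈ good
    · exact (h t).1.imp fun c hc _ => hc
    · exact ⟨0, fun h' => absurd h' h⟩
  choose L hL using hex
  set N : ℝ≥0 → Ω → ℝ := fun t => good.indicator (L t) with hN
  have hlim : ∀ t ω, Tendsto (fun n => good.indicator (M (dyadicAbove n t)) ω) atTop
      (𝓝 (N t ω)) := by
    intro t ω
    by_cases h : ω ∈ good
    · simp only [hN, indicator_of_mem h]
      exact (hL t ω h).comp (tendsto_dyadicAbove_nhdsWithin t)
    · simp only [hN, indicator_of_notMem h]
      exact tendsto_const_nhds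
  have hadapt : StronglyAdapted F N := by
    intro t
    refine stronglyMeasurable_of_forall_gt fun s hs => ?_
    obtain ⟨n₀, hn₀⟩ := eventually_atTop.1 ((tendsto_dyadicAbove t).eventually_lt_const hs)
    -- The shift by `n₀` keeps all approximating times below `s`.
    refine @stronglyMeasurable_of_tendsto _ _ _ (F s) _ _ atTop _ _
      (fun n => good.indicator (M (dyadicAbove (n + n₀) t))) _ (fun n => ?_) ?_
    · exact ((hM.1 _).mono (F.mono (hn₀ _ (by lia)).le)).indicator (hF.measurableSet_of_ae hae s)
    · exact tendsto_pi_nhds.2 fun ω => (hlim t ω).comp (tendsto_add_atTop_nat n₀)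
  refine ⟨N, hadapt, fun ω => ?_, fun t => ?_⟩
  · by_cases h : ω ∈ good
    · simp only [hN, indicator_of_mem h]
      exact isCadlag_of_dyadic_limits (fun t => hL t ω h) fun t => (h t).2
    · simp only [hN, indicator_of_notMem h]
      exact fun t => ⟨continuousWithinAt_const, 0, tendsto_const_nhds⟩
  · have hui : UniformIntegrable (fun n => M (dyadicAbove n t)) 1 P :=
      uniformIntegrable_of_martingale hM (N := t + 1) fun n =>
        (dyadicAbove_le_add n t).trans (by gcongr; exact pow_le_one₀ (by simp) (by
          rw [div_le_one (by norm_num)]; norm_num))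
    have hlim' : ∀ᵐ ω ∂P, Tendsto (fun n => M (dyadicAbove n t) ω) atTop (𝓝 (N t ω)) := by
      filter_upwards [hae] with ω hω
      simpa only [indicator_of_mem hω] using hlim t ω
    obtain ⟨hi, he⟩ := condExp_of_tendsto_of_unifIntegrable (m := F t) (Z := M t) hui hlim'
      fun n => hM.2 t _ (lt_dyadicAbove n t).le
    rwa [condExp_of_stronglyMeasurable (F.le t) (hadapt t) hi] at he

/-! ### Progressive measurability -/

lemma coe_untopA {x : WithTop ℝ≥0} (hx : x ≠ ⊤) : ((x.untopA : ℝ≥0) : WithTop ℝ≥0) = x := by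
  rw [WithTop.untopA_eq_untop hx, WithTop.coe_untop]

lemma measurable_comp_countable {α β γ κ : Type*} [MeasurableSpace α] [MeasurableSpace β]
    [MeasurableSpace γ] [MeasurableSpace κ] [Countable κ] [MeasurableSingletonClass κ]
    {v : κ → β → γ} (hv : ∀ k, Measurable (v k)) {φ : α → κ} (hφ : Measurable φ) :
    Measurable fun p : α × β => v (φ p.1) p.2 :=
  (measurable_from_prod_countable_right (f := fun q : κ × β => v q.1 q.2) hv).comp
    ((hφ.comp measurable_fst).prodMk measurable_snd)

/-- Only countably many times are visited, and the cutoff at `i` makes every value F_i-measurable.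
-/
lemma measurable_comp_dyadicAbove_min {u : ℝ≥0 → Ω → ℝ} (hu : StronglyAdapted F u) (i : ℝ≥0)
    (n : ℕ) : Measurable[Subtype.instMeasurableSpace.prod (F i)]
      fun p : Iic i × Ω => u (min (dyadicAbove n p.1) i) p.2 := by
  have hφ : Measurable fun s : Iic i => ⌊(s : ℝ≥0) * 2 ^ n⌋₊ :=
    Nat.measurable_floor.comp (measurable_subtype_coe.mul_const _)
  have h := @measurable_comp_countable _ _ _ _ _ (F i) _ _ _ _
    (fun (k : ℕ) => u (min (((k + 1 : ℕ) : ℝ≥0) / 2 ^ n) i))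
    (fun k => ((hu _).mono (F.mono (min_le_right _ _))).measurable) _ hφ
  simpa only [dyadicAbove] using h

lemma isStronglyProgressive_of_rightContinuous {u : ℝ≥0 → Ω → ℝ} (hu : StronglyAdapted F u)
    (hc : ∀ ω t, ContinuousWithinAt (fun s => u s ω) (Ici t) t) : IsStronglyProgressive F u := by
  intro i
  refine Measurable.stronglyMeasurable ?_
  refine @measurable_of_tendsto_metrizable _ _ (Subtype.instMeasurableSpace.prod (F i)) _ _ _ _
    (fun n (p : Iic i × Ω) => u (min (dyadicAbove n p.1) i) p.2) _
    (fun n => measurable_comp_dyadicAbove_min hu i n) ?_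
  · rw [tendsto_pi_nhds]
    rintro ⟨⟨s, hs⟩, ω⟩
    refine (hc ω s).tendsto.comp (tendsto_nhdsWithin_iff.2 ⟨?_, Eventually.of_forall fun n => ?_⟩)
    · simpa [min_eq_left (mem_Iic.1 hs)] using (tendsto_dyadicAbove s).min
        (tendsto_const_nhds (x := i))
    · exact le_min (lt_dyadicAbove n s).le hs

lemma isStronglyProgressive_of_cadlag {u : ℝ≥0 → Ω → ℝ} (hu : StronglyAdapted F u)
    (hc : ∀ ω, IsCadlag fun t => u t ω) : IsStronglyProgressive F u :=
  isStronglyProgressive_of_rightContinuous hu fun ω t => (hc ω t).1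

lemma isStronglyProgressive_of_optional {u : ℝ≥0 → Ω → ℝ}
    (hu : Measurable[optional F] (Function.uncurry u)) : IsStronglyProgressive F u := by
  intro i
  refine Measurable.stronglyMeasurable ?_
  -- The sets with measurable trace on [0,i] × Ω form a σ-algebra, so it suffices to treat the
  -- càdlàg generators.
  have hle : optional F ≤ MeasurableSpace.map (fun p : Iic i × Ω => ((p.1 : ℝ≥0), p.2))
      (Subtype.instMeasurableSpace.prod (F i)) := by
    refine iSup₂_le fun Z hZ => ?_
    rw [MeasurableSpace.comap_le_iff_le_map, MeasurableSpace.map_comp]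
    exact fun s hs => ((isStronglyProgressive_of_cadlag hZ.1 hZ.2) i).measurable hs
  exact fun s hs => hle _ (hu hs)

lemma measurable_optional_of_cadlag {u : ℝ≥0 → Ω → ℝ} (hu : StronglyAdapted F u)
    (hc : ∀ ω, IsCadlag fun t => u t ω) : Measurable[optional F] (Function.uncurry u) :=
  Measurable.mono (comap_measurable _) (le_iSup₂_of_le u ⟨hu, hc⟩ le_rfl) le_rfl

lemma measurable_min_prodMk {α : Type*} [MeasurableSpace α] (t : ℝ≥0) :
    Measurable fun p : ℝ≥0 × α => ((⟨min p.1 t, mem_Iic.2 (min_le_right _ _)⟩ : Iic t), p.2) :=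
  ((measurable_fst.min measurable_const).subtype_mk).prodMk measurable_snd

lemma measurable_comp_min_of_progressive {u : ℝ≥0 → Ω → ℝ} (hu : IsStronglyProgressive F u)
    (t : ℝ≥0) : Measurable[MeasurableSpace.prod inferInstance (F t)]
      fun p : ℝ≥0 × Ω => u (min p.1 t) p.2 := by
  exact (hu t).measurable.comp (@measurable_min_prodMk _ (F t) t)

lemma measurable_uncurry_of_progressive {u : ℝ≥0 → Ω → ℝ} (hu : IsStronglyProgressive F u) :
    Measurable (Function.uncurry u) := by
  refine measurable_of_tendsto_metrizable
    (f := fun (n : ℕ) (p : ℝ≥0 × Ω) => u (min p.1 n) p.2) (fun n => ?_) ?_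
  · exact (measurable_comp_min_of_progressive hu n).mono
      (sup_le_sup le_rfl (MeasurableSpace.comap_mono (F.le _))) le_rfl
  · rw [tendsto_pi_nhds]
    rintro ⟨s, ω⟩
    obtain ⟨n₀, hn₀⟩ := exists_nat_ge s
    refine tendsto_atTop_of_eventually_const (i₀ := n₀) fun n hn => ?_
    simp [Function.uncurry, min_eq_left (hn₀.trans (by exact_mod_cast hn : (n₀ : ℝ≥0) ≤ n))]

/-! ### Optional sampling in continuous time -/

lemma isStoppingTime_dyadicAbove_min {τ : Ω → WithTop ℝ≥0} (hτ : IsStoppingTime F τ) {N : ℝ≥0}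
    (hN : ∀ ω, τ ω ≤ N) (n : ℕ) :
    IsStoppingTime F fun ω => ((min (dyadicAbove n (τ ω).untopA) N : ℝ≥0) : WithTop ℝ≥0) := by
  intro i
  by_cases hi : N ≤ i
  · have : {ω | ((min (dyadicAbove n (τ ω).untopA) N : ℝ≥0) : WithTop ℝ≥0) ≤ i} = univ := by
      ext ω
      simp only [mem_ofPred_eq, WithTop.coe_le_coe, mem_univ, iff_true]
      exact (min_le_right _ _).trans hi
    rw [this]
    exact MeasurableSet.univ
  · have : {ω | ((min (dyadicAbove n (τ ω).untopA) N : ℝ≥0) : WithTop ℝ≥0) ≤ i} =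
        {ω | τ ω < (((⌊i * 2 ^ n⌋₊ : ℝ≥0) / 2 ^ n : ℝ≥0) : WithTop ℝ≥0)} := by
      ext ω
      have hne : τ ω ≠ ⊤ := ne_top_of_le_ne_top WithTop.coe_ne_top (hN ω)
      simp only [mem_ofPred_eq, WithTop.coe_le_coe, min_le_iff, hi, or_false, dyadicAbove_le_iff,
        WithTop.untopA_lt_iff hne]
    rw [this]
    exact hτ.measurableSet_lt_le (floor_dyadic_le n i)

/-- Optional sampling: a càdlàg martingale at a stopping time bounded by `N` is the conditional
expectation of its value at `N`. -/
theorem stoppedValue_ae_eq_condExp_of_cadlag [IsFiniteMeasure P] (hM : Martingale M F P)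
    (hc : ∀ ω, IsCadlag fun t => M t ω) {τ : Ω → WithTop ℝ≥0} (hτ : IsStoppingTime F τ) {N : ℝ≥0}
    (hN : ∀ ω, τ ω ≤ N) :
    Integrable (stoppedValue M τ) P ∧ stoppedValue M τ =ᵐ[P] P[M N | hτ.measurableSpace] := by
  set σ : ℕ → Ω → WithTop ℝ≥0 := fun n ω =>
    ((min (dyadicAbove n (τ ω).untopA) N : ℝ≥0) : WithTop ℝ≥0) with hσ
  have hst : ∀ n, IsStoppingTime F (σ n) := isStoppingTime_dyadicAbove_min hτ hN
  have hle : ∀ n, τ ≤ σ n := by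
    intro n ω
    have hne : τ ω ≠ ⊤ := ne_top_of_le_ne_top WithTop.coe_ne_top (hN ω)
    have h := hN ω
    rw [← coe_untopA hne, WithTop.coe_le_coe] at h
    conv_lhs => rw [← coe_untopA hne]
    exact WithTop.coe_le_coe.2 (le_min (lt_dyadicAbove n _).le h)
  have hσN : ∀ n ω, σ n ω ≤ N := fun n ω => WithTop.coe_le_coe.2 (min_le_right _ _)
  have hcount : ∀ n, (range (σ n)).Countable := by
    intro n
    refine (countable_range fun k : ℕ =>
      ((min (((k + 1 : ℕ) : ℝ≥0) / 2 ^ n) N : ℝ≥0) : WithTop ℝ≥0)).mono ?_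
    rintro _ ⟨ω, rfl⟩
    exact ⟨_, rfl⟩
  -- Each approximating time has countable range, where discrete optional sampling applies;
  -- right-continuity and uniform integrability carry the identity to τ.
  have heq : ∀ n, stoppedValue M (σ n) =ᵐ[P] P[M N | (hst n).measurableSpace] := fun n =>
    hM.stoppedValue_ae_eq_condExp_of_le_const_of_countable_range (hst n) (hσN n) (hcount n)
  have hui : UniformIntegrable (fun n => stoppedValue M (σ n)) 1 P :=
    ((hM.integrable N).uniformIntegrable_condExp fun n => (hst n).measurableSpace_le).ae_eq
      fun n => (heq n).symm
  have hlim : ∀ ω, Tendsto (fun n => stoppedValue M (σ n) ω) atTop (𝓝 (stoppedValue M τ ω)) := by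
    intro ω
    have h : (τ ω).untopA ≤ N := WithTop.untopA_le (hN ω)
    change Tendsto (fun n => M (min (dyadicAbove n (τ ω).untopA) N) ω) atTop _
    refine ((hc ω _).1).tendsto.comp
      (tendsto_nhdsWithin_iff.2 ⟨?_, Eventually.of_forall fun n => ?_⟩)
    · simpa [min_eq_left h] using (tendsto_dyadicAbove (τ ω).untopA).min
        (tendsto_const_nhds (x := N))
    · exact le_min (lt_dyadicAbove n _).le h
  obtain ⟨hi, he⟩ := condExp_of_tendsto_of_unifIntegrable (m := hτ.measurableSpace)
    (Z := P[M N | hτ.measurableSpace]) hui (Eventually.of_forall hlim) fun n =>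
      (condExp_congr_ae (heq n)).trans
        (condExp_condExp_of_le (hτ.measurableSpace_mono (hst n) (hle n)) (hst n).measurableSpace_le)
  refine ⟨hi, ?_⟩
  have hmeas : StronglyMeasurable[hτ.measurableSpace] (stoppedValue M τ) :=
    (measurable_stoppedValue (isStronglyProgressive_of_cadlag hM.1 hc) hτ).stronglyMeasurable
  rwa [condExp_of_stronglyMeasurable hτ.measurableSpace_le hmeas hi] at he

/-! ### Integrals with respect to Lebesgue measure on the time axis -/

lemma measurableEmbedding_coe_nnreal : MeasurableEmbedding ((↑) : ℝ≥0 → ℝ) :=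
  MeasurableEmbedding.subtype_coe measurableSet_Ici

lemma leb_Ioc_lt_top (s t : ℝ≥0) : leb (Ioc s t) < ∞ := by
  rw [leb, measurableEmbedding_coe_nnreal.comap_apply]
  refine lt_of_le_of_lt (measure_mono (t := Icc (s : ℝ) t) ?_) (by simp)
  rintro _ ⟨u, hu, rfl⟩
  exact ⟨hu.1.le, hu.2⟩

instance isFiniteMeasure_leb_restrict (s t : ℝ≥0) : IsFiniteMeasure (leb.restrict (Ioc s t)) :=
  ⟨by rw [Measure.restrict_apply_univ]; exact leb_Ioc_lt_top s t⟩

instance nullSingletonClass_leb : NullSingletonClass leb :=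
  ⟨fun x => by
    rw [leb, measurableEmbedding_coe_nnreal.comap_apply]
    simp⟩

/-- Moves the upper limit into the integrand, so that dominated convergence and Fubini can work on a
fixed interval. -/
lemma setIntegral_Ioc_eq_indicator {f : ℝ≥0 → ℝ} {s t : ℝ≥0} (hst : s ≤ t) :
    ∫ u in Ioc 0 s, f u ∂leb = ∫ u in Ioc 0 t, (Iic s).indicator f u ∂leb := by
  rw [setIntegral_indicator measurableSet_Iic, Ioc_inter_Iic, min_eq_right hst]

lemma continuous_primitive_leb {f : ℝ≥0 → ℝ} (hf : ∀ t, IntegrableOn f (Ioc 0 t) leb) :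
    Continuous fun t => ∫ u in Ioc 0 t, f u ∂leb := by
  rw [continuous_iff_continuousAt]
  intro t
  have h : ContinuousAt (fun s => ∫ u in Ioc 0 (t + 1), (Iic s).indicator f u ∂leb) t := by
    refine continuousAt_of_dominated (bound := fun u => ‖f u‖) ?_ ?_ (hf (t + 1)).norm ?_
    · exact Eventually.of_forall fun s =>
        (hf (t + 1)).aestronglyMeasurable.indicator measurableSet_Iic
    · exact Eventually.of_forall fun s => Eventually.of_forall fun u => norm_indicator_le_norm_self _ _
    · have hne : ∀ᵐ u ∂leb.restrict (Ioc 0 (t + 1)), u ≠ t :=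
        ae_restrict_of_ae (by simp [ae_iff])
      filter_upwards [hne] with u hu
      rcases lt_or_gt_of_ne hu with hu | hu
      · refine continuousAt_const.congr (f := fun _ => f u) ?_
        filter_upwards [lt_mem_nhds hu] with s hs
        rw [indicator_of_mem (mem_Iic.2 hs.le)]
      · refine continuousAt_const.congr (f := fun _ => (0 : ℝ)) ?_
        filter_upwards [gt_mem_nhds hu] with s hs
        rw [indicator_of_notMem (by simpa using hs)]
  refine h.congr ?_
  filter_upwards [gt_mem_nhds (lt_add_one t)] with s hs
  exact (setIntegral_Ioc_eq_indicator hs.le).symm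

/-- The time integral of a progressive process is adapted. -/
lemma stronglyMeasurable_setIntegral_of_progressive {u : ℝ≥0 → Ω → ℝ}
    (hu : IsStronglyProgressive F u) (t : ℝ≥0) :
    StronglyMeasurable[F t] fun ω => ∫ s in Ioc 0 t, u s ω ∂leb := by
  have h := @MeasureTheory.StronglyMeasurable.integral_prod_left' _ _ _ _ (F t)
    (leb.restrict (Ioc 0 t)) _ _ _ _
    (measurable_comp_min_of_progressive hu t).stronglyMeasurable
  refine (congrArg _ ?_).mp h
  funext ω
  refine setIntegral_congr_fun measurableSet_Ioc fun s hs => ?_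
  simp only [min_eq_left hs.2]

/-- The Stieltjes measure of a primitive is the measure with the given density. -/
lemma stieltjes_restrict_eq_withDensity {a : ℝ≥0 → ℝ} (ha0 : ∀ u, 0 ≤ a u)
    {S : StieltjesFunction ℝ≥0} (hai : ∀ t, IntegrableOn a (Ioc 0 t) leb)
    (hS : ∀ t, S t = ∫ u in Ioc 0 t, a u ∂leb) (t : ℝ≥0) :
    S.measure.restrict (Ioc 0 t) =
      (leb.restrict (Ioc 0 t)).withDensity fun u => ENNReal.ofReal (a u) := by
  have hfin : IsFiniteMeasure (S.measure.restrict (Ioc 0 t)) :=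
    ⟨by rw [Measure.restrict_apply_univ, S.measure_Ioc]; exact ENNReal.ofReal_lt_top⟩
  refine Measure.ext_of_Iic _ _ fun s => ?_
  rw [Measure.restrict_apply measurableSet_Iic, withDensity_apply _ measurableSet_Iic,
    Measure.restrict_restrict measurableSet_Iic, inter_comm, Ioc_inter_Iic, S.measure_Ioc,
    hS, hS, Ioc_self, setIntegral_empty, sub_zero,
    ofReal_integral_eq_lintegral_ofReal (hai _) (Eventually.of_forall ha0)]

lemma IsStieltjesIntegral.eq_setIntegral {a b α β : ℝ≥0 → ℝ} (ha0 : ∀ u, 0 ≤ a u)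
    (ham : Measurable a) (hai : ∀ t, IntegrableOn a (Ioc 0 t) leb)
    (hα : ∀ t, α t = ∫ u in Ioc 0 t, a u ∂leb) (h : IsStieltjesIntegral b α β) (t : ℝ≥0) :
    β t = ∫ u in Ioc 0 t, b u * a u ∂leb := by
  obtain ⟨S, hS, hb⟩ := h
  rw [(hb t).2, stieltjes_restrict_eq_withDensity ha0 hai (fun t => (hS t).trans (hα t)),
    integral_withDensity_eq_integral_toReal_smul ham.ennreal_ofReal
      (Eventually.of_forall fun u => ENNReal.ofReal_lt_top)]
  refine integral_congr_ae (Eventually.of_forall fun u => ?_)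
  simp only [ENNReal.toReal_ofReal (ha0 u), smul_eq_mul, mul_comm]

/-! ### Conditional expectations of σ-integrable variables -/

section CondExp

variable {m : MeasurableSpace Ω} {ξ η η' : Ω → ℝ}

lemma isCondExp_condExp (hξ : Integrable ξ P) : IsCondExp m P ξ (P[ξ | m]) :=
  ⟨fun _ => univ, monotone_const, fun _ => MeasurableSet.univ, iUnion_const _, fun _ => by simp [hξ]⟩

/-- On the intersection of the n-th sets of the two exhausting sequences, both sides condition the
same integrable variable; by monotonicity these intersections exhaust Ω. -/
lemma IsCondExp.ae_unique (h : IsCondExp m P ξ η) (h' : IsCondExp m P ξ η') : η =ᵐ[P] η' := by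
  obtain ⟨A, hA, hAm, hAu, hAe⟩ := h
  obtain ⟨A', hA', hAm', hAu', hAe'⟩ := h'
  have key : ∀ n, (A n ∩ A' n).indicator η =ᵐ[P] (A n ∩ A' n).indicator η' := by
    intro n
    have h1 := condExp_indicator (hAe n).1 (hAm' n)
    have h2 := condExp_indicator (hAe' n).1 (hAm n)
    rw [indicator_indicator] at h1 h2
    rw [inter_comm] at h1
    filter_upwards [h1, h2, (hAe n).2, (hAe' n).2] with ω e1 e2 e3 e4
    rw [e1] at e2
    by_cases hω : ω ∈ A n ∩ A' n
    · simp only [indicator_of_mem hω]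
      simpa only [indicator_of_mem hω.1, indicator_of_mem hω.2, e3, e4] using e2
    · simp only [indicator_of_notMem hω]
  filter_upwards [ae_all_iff.2 key] with ω hω
  obtain ⟨n, hn⟩ := mem_iUnion.1 (hAu ▸ mem_univ ω)
  obtain ⟨n', hn'⟩ := mem_iUnion.1 (hAu' ▸ mem_univ ω)
  have hmem : ω ∈ A (max n n') ∩ A' (max n n') :=
    ⟨hA (le_max_left _ _) hn, hA' (le_max_right _ _) hn'⟩
  simpa only [indicator_of_mem hmem] using hω (max n n')

end CondExp

lemma valueAt_const (Z : ℝ≥0 → Ω → ℝ) (t : ℝ≥0) : valueAt Z (fun _ => (t : WithTop ℝ≥0)) = Z t := by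
  have h : {_ω : Ω | (t : WithTop ℝ≥0) < ⊤} = univ := by
    ext ω
    simpa using WithTop.coe_lt_top t
  rw [valueAt, h, indicator_univ, stoppedValue_const]

lemma IsOptionalProjection.isCondExp {Z Y : ℝ≥0 → Ω → ℝ} (h : IsOptionalProjection F P Z Y)
    (t : ℝ≥0) : IsCondExp (F t) P (Z t) (Y t) := by
  have := h.condExp_eq _ (isStoppingTime_const F t)
  rwa [IsStoppingTime.measurableSpace_const, valueAt_const, valueAt_const] at this

lemma IsOptionalProjection.ae_eq_condExp {Z Y : ℝ≥0 → Ω → ℝ} (h : IsOptionalProjection F P Z Y)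
    {t : ℝ≥0} (ht : Integrable (Z t) P) : Y t =ᵐ[P] P[Z t | F t] :=
  (h.isCondExp t).ae_unique (isCondExp_condExp ht)

lemma IsOptionalProjection.isStronglyProgressive {Z Y : ℝ≥0 → Ω → ℝ}
    (h : IsOptionalProjection F P Z Y) : IsStronglyProgressive F Y :=
  isStronglyProgressive_of_optional h.measurable_optional

/-- Under immersion, an `𝓖_u`-measurable variable has the same conditional expectation given `𝓕_t`,
`t ≥ u`, as given `𝓕_u`. -/
lemma Immersed.setIntegral_condExp [IsFiniteMeasure P] (h : Immersed F G P) {u t : ℝ≥0}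
    (hut : u ≤ t) {ξ : Ω → ℝ} (hξ : Integrable ξ P) (hξm : StronglyMeasurable[G u] ξ)
    {Λ : Set Ω} (hΛ : MeasurableSet[F t] Λ) :
    ∫ ω in Λ, ξ ω ∂P = ∫ ω in Λ, (P[ξ | F u]) ω ∂P := by
  set e : Ω → ℝ := Λ.indicator 1 with he
  have hΛm : MeasurableSet Λ := F.le t _ hΛ
  have hei : Integrable e P := (integrable_const (1 : ℝ)).indicator hΛm
  have hem : StronglyMeasurable[F t] e := stronglyMeasurable_one.indicator hΛ
  have heb : ∀ ω, ‖e ω‖ ≤ 1 := fun ω => by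
    by_cases hω : ω ∈ Λ <;> simp [he, hω]
  -- Immersion is applied to the martingale generated by the indicator of Λ, giving E(1_Λ | G_u) =
  -- E(1_Λ | F_u). Both sides of the claim then equal E(ξ E(1_Λ | F_u)).
  have hmart := h _ (martingale_condExp e F P)
  have hGF : P[e | G u] =ᵐ[P] P[e | F u] := by
    have h1 : P[P[e | F t] | G u] =ᵐ[P] P[e | F u] := hmart.2 u t hut
    rwa [condExp_of_stronglyMeasurable (F.le t) hem hei] at h1
  have hmul : ∀ f : Ω → ℝ, ∫ ω in Λ, f ω ∂P = ∫ ω, (f * e) ω ∂P := by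
    intro f
    rw [← integral_indicator hΛm]
    congr 1
    ext ω
    by_cases hω : ω ∈ Λ <;> simp [he, hω]
  have hfe : ∀ f : Ω → ℝ, Integrable f P → Integrable (f * e) P := fun f hf =>
    hf.mul_bdd hei.aestronglyMeasurable (Eventually.of_forall heb)
  have hcb : ∀ᵐ ω ∂P, ‖(P[e | F u]) ω‖ ≤ 1 := by
    exact ae_bdd_abs_condExp_of_ae_bdd_abs (m := F u) (R := (1 : ℝ)) (f := e) (μ := P)
      (Eventually.of_forall heb)
  have h_int : Integrable (ξ * P[e | F u]) P :=
    hξ.mul_bdd integrable_condExp.aestronglyMeasurable hcb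
  rw [hmul, hmul, ← integral_condExp (G.le u), ← integral_condExp (F.le u) (f := P[ξ | F u] * e)]
  have e1 : P[ξ * e | G u] =ᵐ[P] ξ * P[e | F u] :=
    (condExp_mul_of_stronglyMeasurable_left hξm (hfe ξ hξ) hei).trans
      (EventuallyEq.rfl.mul hGF)
  have e2 : P[P[ξ | F u] * e | F u] =ᵐ[P] P[ξ | F u] * P[e | F u] :=
    condExp_mul_of_stronglyMeasurable_left stronglyMeasurable_condExp
      (hfe _ integrable_condExp) hei
  have e3 : P[ξ * P[e | F u] | F u] =ᵐ[P] P[ξ | F u] * P[e | F u] :=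
    condExp_mul_of_stronglyMeasurable_right stronglyMeasurable_condExp h_int hξ
  rw [integral_congr_ae e1, integral_congr_ae (e2.trans e3.symm), integral_condExp (F.le u)]

/-! ### Processes with an integrable drift -/

section Drift

variable [IsProbabilityMeasure P] {J D : ℝ≥0 → Ω → ℝ}

lemma ae_integrableOn_paths
    (hJ : ∀ t, Integrable (Function.uncurry J) ((leb.restrict (Ioc 0 t)).prod P)) :
    ∀ᵐ ω ∂P, ∀ t, IntegrableOn (fun u => J u ω) (Ioc 0 t) leb := by
  have h : ∀ᵐ ω ∂P, ∀ n : ℕ, IntegrableOn (fun u => J u ω) (Ioc 0 (n : ℝ≥0)) leb :=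
    ae_all_iff.2 fun n => (hJ n).prod_left_ae
  filter_upwards [h] with ω hω t
  obtain ⟨n, hn⟩ := exists_nat_ge t
  exact (hω n).mono_set (Ioc_subset_Ioc_right hn)

lemma integrable_stoppedValue_of_drift
    (hJ : ∀ t, Integrable (Function.uncurry J) ((leb.restrict (Ioc 0 t)).prod P))
    (hD : ∀ᵐ ω ∂P, ∀ t, D t ω = ∫ u in Ioc 0 t, J u ω ∂leb) (hDp : IsStronglyProgressive G D)
    {τ : Ω → WithTop ℝ≥0} (hτ : IsStoppingTime G τ) {N : ℝ≥0} (hN : ∀ ω, τ ω ≤ N) :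
    Integrable (stoppedValue D τ) P := by
  refine Integrable.mono' (hJ N).integral_norm_prod_right
    ((stronglyMeasurable_stoppedValue_of_le hDp hτ hN).mono (G.le N)).aestronglyMeasurable ?_
  filter_upwards [hD, ae_integrableOn_paths hJ] with ω hω hi
  rw [stoppedValue, hω]
  refine (norm_integral_le_integral_norm _).trans ?_
  exact setIntegral_mono_set (hi N).norm (Eventually.of_forall fun u => norm_nonneg _)
    (Ioc_subset_Ioc_right (WithTop.untopA_le (hN ω))).eventuallyLE

lemma integrable_of_drift
    (hJ : ∀ t, Integrable (Function.uncurry J) ((leb.restrict (Ioc 0 t)).prod P))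
    (hD : ∀ᵐ ω ∂P, ∀ t, D t ω = ∫ u in Ioc 0 t, J u ω ∂leb) (hDp : IsStronglyProgressive G D)
    (t : ℝ≥0) : Integrable (D t) P :=
  integrable_stoppedValue_of_drift hJ hD hDp (isStoppingTime_const G t) fun _ => le_rfl

lemma integral_drift_indicator_eq_zero {N : ℝ≥0}
    (hJ : Integrable (Function.uncurry J) ((leb.restrict (Ioc 0 N)).prod P))
    {Λ : Set (ℝ≥0 × Ω)} (hΛ : MeasurableSet Λ)
    (h0 : ∀ᵐ u ∂leb.restrict (Ioc 0 N), ∫ ω in {ω | (u, ω) ∈ Λ}, J u ω ∂P = 0) :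
    ∫ ω, ∫ u in Ioc 0 N, Λ.indicator (Function.uncurry J) (u, ω) ∂leb ∂P = 0 := by
  have hi : Integrable (Λ.indicator (Function.uncurry J)) ((leb.restrict (Ioc 0 N)).prod P) :=
    hJ.indicator hΛ
  rw [← integral_prod_symm _ hi, integral_prod _ hi]
  refine integral_eq_zero_of_ae ?_
  filter_upwards [h0] with u hu
  have hΛu : MeasurableSet {ω | (u, ω) ∈ Λ} := measurable_prodMk_left hΛ
  rw [← integral_indicator hΛu] at hu
  exact hu

lemma condExp_eq_zero_of_setIntegral {m : MeasurableSpace Ω} (hm : m ≤ mΩ) {ξ : Ω → ℝ}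
    (hξ : Integrable ξ P) (h : ∀ s, MeasurableSet[m] s → ∫ ω in s, ξ ω ∂P = 0) :
    P[ξ | m] =ᵐ[P] 0 := by
  refine (ae_eq_condExp_of_forall_setIntegral_eq hm hξ (fun _ _ _ => integrableOn_zero)
    (fun s hs _ => ?_) aestronglyMeasurable_zero).symm
  rw [h s hs]
  simp

/-- If the drift has vanishing conditional expectations, then the process satisfies the
martingale property at stopping times. -/
lemma condExp_stoppedValue_of_drift (hFG : F ≤ G)
    (hJ : ∀ t, Integrable (Function.uncurry J) ((leb.restrict (Ioc 0 t)).prod P))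
    (hD : ∀ᵐ ω ∂P, ∀ t, D t ω = ∫ u in Ioc 0 t, J u ω ∂leb) (hDp : IsStronglyProgressive G D)
    (hJ0 : ∀ t, ∀ᵐ u ∂leb.restrict (Ioc 0 t), P[J u | F u] =ᵐ[P] 0)
    {τ : Ω → WithTop ℝ≥0} (hτ : IsStoppingTime F τ) {N : ℝ≥0} (hN : ∀ ω, τ ω ≤ N) :
    P[D N | hτ.measurableSpace] =ᵐ[P] P[stoppedValue D τ | hτ.measurableSpace] := by
  have hτG : IsStoppingTime G τ := fun i => hFG i _ (hτ i)
  have hi1 : Integrable (D N) P := integrable_of_drift hJ hD hDp N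
  have hi2 := integrable_stoppedValue_of_drift hJ hD hDp hτG hN
  have key : P[D N - stoppedValue D τ | hτ.measurableSpace] =ᵐ[P] 0 := by
    refine condExp_eq_zero_of_setIntegral hτ.measurableSpace_le (hi1.sub hi2) fun s hs => ?_
    have hσ : Measurable fun ω => (τ ω).untopA :=
      ((hτ.measurable_of_le hN).mono (F.le N) le_rfl).untopA
    have hsm : MeasurableSet s := hτ.measurableSpace_le _ hs
    -- Integrating `J` over the times in this region gives D_N - D_τ on `s`. Its section at time u
    -- lies in F_u because `s` belongs to F_τ.
    set Λ : Set (ℝ≥0 × Ω) := {p : ℝ≥0 × Ω | p.2 ∈ s ∧ (τ p.2).untopA < p.1} with hΛ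
    have hΛm : MeasurableSet Λ :=
      (measurable_snd hsm).inter
        (measurableSet_lt (f := fun p : ℝ≥0 × Ω => (τ p.2).untopA) (g := fun p => p.1)
          (hσ.comp measurable_snd) measurable_fst)
    have h0 := integral_drift_indicator_eq_zero (hJ N) hΛm ?_
    · rw [← integral_indicator hsm, ← h0]
      refine integral_congr_ae ?_
      filter_upwards [hD, ae_integrableOn_paths hJ] with ω hω hiω
      by_cases hωs : ω ∈ s
      · have hle : (τ ω).untopA ≤ N := WithTop.untopA_le (hN ω)
        rw [indicator_of_mem hωs, Pi.sub_apply, stoppedValue, hω, hω, setIntegral_Ioc_eq_indicator hle,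
          ← integral_sub (hiω N) ((hiω N).indicator measurableSet_Iic)]
        refine integral_congr_ae (Eventually.of_forall fun u => ?_)
        by_cases hu : (τ ω).untopA < u
        · simp [hΛ, indicator, hωs, hu, Function.uncurry]
        · simp [hΛ, indicator, hu, not_lt.1 hu]
      · rw [indicator_of_notMem hωs]
        simp [hΛ, indicator, hωs]
    · filter_upwards [hJ0 N, (hJ N).prod_right_ae] with u hu hui
      have hmem : MeasurableSet[F u] {ω | (u, ω) ∈ Λ} := by
        have : {ω | (u, ω) ∈ Λ} = (s ∩ {ω | τ ω ≤ u}) ∩ {ω | τ ω < u} := by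
          ext ω
          have hne : τ ω ≠ ⊤ := ne_top_of_le_ne_top WithTop.coe_ne_top (hN ω)
          simp only [hΛ, mem_ofPred_eq, mem_inter_iff, WithTop.untopA_lt_iff hne]
          exact ⟨fun h => ⟨⟨h.1, h.2.le⟩, h.2⟩, fun h => ⟨h.1.1, h.2⟩⟩
        rw [this]
        exact (hs.2 u).inter (hτ.measurableSet_lt u)
      have hJu : Integrable (J u) P := hui
      rw [← setIntegral_condExp (F.le u) hJu hmem, integral_eq_zero_of_ae (ae_restrict_of_ae hu)]
  have h := (condExp_sub hi1 hi2 hτ.measurableSpace).symm.trans key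
  filter_upwards [h] with ω hω
  simpa [sub_eq_zero] using hω

/-- Used under immersion: J_u is tested against all of F_t with t ≥ u, which is more than E(J_u |
F_u) = 0 provides. -/
lemma condExp_eq_zero_of_drift
    (hJ : ∀ t, Integrable (Function.uncurry J) ((leb.restrict (Ioc 0 t)).prod P))
    (hD : ∀ᵐ ω ∂P, ∀ t, D t ω = ∫ u in Ioc 0 t, J u ω ∂leb) (hDp : IsStronglyProgressive G D)
    {t : ℝ≥0} (h0 : ∀ s, MeasurableSet[F t] s →
      ∀ᵐ u ∂leb.restrict (Ioc 0 t), ∫ ω in s, J u ω ∂P = 0) :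
    P[D t | F t] =ᵐ[P] 0 := by
  refine condExp_eq_zero_of_setIntegral (F.le t) (integrable_of_drift hJ hD hDp t) fun s hs => ?_
  have hsm : MeasurableSet s := F.le t _ hs
  rw [← integral_indicator hsm, ← integral_drift_indicator_eq_zero (hJ t)
    (measurable_snd hsm : MeasurableSet (Prod.snd ⁻¹' s)) (h0 s hs)]
  refine integral_congr_ae ?_
  filter_upwards [hD] with ω hω
  by_cases hωs : ω ∈ s
  · rw [indicator_of_mem hωs, hω]
    refine integral_congr_ae (Eventually.of_forall fun u => ?_)
    simp [indicator, hωs, Function.uncurry]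
  · simp [indicator, hωs]

end Drift

/-! ### Modifications, indistinguishability, and reduction to bounded stopping times. -/

lemma martingale_of_modification {M N : ℝ≥0 → Ω → ℝ} (hM : Martingale M F P)
    (hN : StronglyAdapted F N) (h : ∀ t, N t =ᵐ[P] M t) : Martingale N F P :=
  ⟨hN, fun s t hst => (condExp_congr_ae (h t)).trans ((hM.2 s t hst).trans (h s).symm)⟩

lemma IsCadlag.add {f g : ℝ≥0 → ℝ} (hf : IsCadlag f) (hg : IsCadlag g) :
    IsCadlag fun t => f t + g t := fun t => by
  obtain ⟨hf1, l, hl⟩ := hf t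
  obtain ⟨hg1, r, hr⟩ := hg t
  exact ⟨hf1.add hg1, l + r, hl.add hr⟩

lemma isCadlag_of_continuous {f : ℝ≥0 → ℝ} (hf : Continuous f) : IsCadlag f := fun t =>
  ⟨hf.continuousWithinAt, f t, hf.continuousAt.tendsto.mono_left nhdsWithin_le_nhds⟩

lemma countable_dyadics : dyadics.Countable := by
  have : dyadics = range fun p : ℕ × ℕ => (p.2 : ℝ≥0) / 2 ^ p.1 := by
    ext x
    simp [dyadics, eq_comm]
  rw [this]
  exact countable_range _

/-- A càdlàg process that vanishes almost surely at every time is indistinguishable from `0`. -/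
lemma ae_forall_eq_zero_of_cadlag {M : ℝ≥0 → Ω → ℝ} (hc : ∀ ω, IsCadlag fun t => M t ω)
    (h : ∀ t, M t =ᵐ[P] 0) : ∀ᵐ ω ∂P, ∀ t, M t ω = 0 := by
  have h' : ∀ᵐ ω ∂P, ∀ t ∈ dyadics, M t ω = 0 := (ae_ball_iff countable_dyadics).2 fun t _ => h t
  filter_upwards [h'] with ω hω t
  have hlim : Tendsto (fun n => M (dyadicAbove n t) ω) atTop (𝓝 (M t ω)) :=
    (hc ω t).1.tendsto.comp (tendsto_nhdsWithin_iff.2 ⟨tendsto_dyadicAbove t,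
      Eventually.of_forall fun n => (lt_dyadicAbove n t).le⟩)
  simp only [hω _ (dyadicAbove_mem _ t)] at hlim
  exact tendsto_nhds_unique hlim tendsto_const_nhds

/-- To verify that an adapted càdlàg process is an optional projection it suffices to consider
bounded stopping times. -/
lemma isOptionalProjection_of_bounded [IsFiniteMeasure P] {Z Y : ℝ≥0 → Ω → ℝ}
    (hYa : StronglyAdapted F Y) (hYc : ∀ ω, IsCadlag fun t => Y t ω)
    (h : ∀ (τ : Ω → WithTop ℝ≥0) (hτ : IsStoppingTime F τ) (N : ℝ≥0), (∀ ω, τ ω ≤ N) →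
      Integrable (stoppedValue Z τ) P ∧
        P[stoppedValue Z τ | hτ.measurableSpace] =ᵐ[P] stoppedValue Y τ) :
    IsOptionalProjection F P Z Y := by
  refine ⟨measurable_optional_of_cadlag hYa hYc, fun τ hτ => ?_⟩
  -- The exhausting sets are {τ ≤ n} ∪ {τ = ∞}. The second piece is needed to cover Ω and costs
  -- nothing, since `valueAt` vanishes there.
  have hind : ∀ (n : ℕ) (W : ℝ≥0 → Ω → ℝ),
      ({ω | τ ω ≤ (n : ℝ≥0)} ∪ {ω | τ ω = ⊤}).indicator (valueAt W τ) =
        {ω | τ ω ≤ (n : ℝ≥0)}.indicator (stoppedValue W fun ω => min (τ ω) (n : ℝ≥0)) := by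
    intro n W
    ext ω
    by_cases h1 : τ ω ≤ ((n : ℝ≥0) : WithTop ℝ≥0)
    · have h2 : ω ∈ {ω | τ ω < ⊤} := h1.trans_lt (WithTop.coe_lt_top _)
      rw [indicator_of_mem (s := {ω | τ ω ≤ (n : ℝ≥0)} ∪ {ω | τ ω = ⊤}) (Or.inl h1), indicator_of_mem (s := {ω | τ ω ≤ (n : ℝ≥0)}) h1, valueAt,
        indicator_of_mem h2, stoppedValue, stoppedValue, min_eq_left h1]
    · rw [indicator_of_notMem (s := {ω | τ ω ≤ (n : ℝ≥0)}) h1]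
      by_cases h2 : τ ω = ⊤
      · rw [indicator_of_mem (s := {ω | τ ω ≤ (n : ℝ≥0)} ∪ {ω | τ ω = ⊤}) (Or.inr h2), valueAt,
          indicator_of_notMem (s := {ω | τ ω < ⊤}) fun h => h.ne h2]
      · exact indicator_of_notMem (fun h => h.elim h1 h2) _
  refine ⟨fun n => {ω | τ ω ≤ (n : ℝ≥0)} ∪ {ω | τ ω = ⊤}, ?_, fun n => ?_, ?_, fun n => ?_⟩
  · intro n n' hn ω hω
    have hnn : ((n : ℝ≥0) : WithTop ℝ≥0) ≤ (n' : ℝ≥0) :=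
      WithTop.coe_le_coe.2 (by exact_mod_cast hn)
    exact Or.imp (fun h : τ ω ≤ (n : ℝ≥0) => h.trans hnn) id hω
  · refine (hτ.measurableSet_le' _).union ⟨hτ.measurableSet_eq_top', fun i => ?_⟩
    have : {ω | τ ω = ⊤} ∩ {ω | τ ω ≤ i} = ∅ := by
      refine eq_empty_of_forall_notMem fun ω hω => ?_
      have h2 : (⊤ : WithTop ℝ≥0) ≤ i := hω.1 ▸ hω.2
      exact absurd h2 (not_le.2 (WithTop.coe_lt_top i))
    rw [this]
    exact @MeasurableSet.empty _ (F i)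
  · refine eq_univ_of_forall fun ω => mem_iUnion.2 ?_
    by_cases h2 : τ ω = ⊤
    · exact ⟨0, Or.inr h2⟩
    · obtain ⟨n, hn⟩ := exists_nat_ge (τ ω).untopA
      exact ⟨n, Or.inl ((WithTop.untopA_le_iff h2).1 hn)⟩
  · rw [hind, hind]
    obtain ⟨hi, he⟩ := h _ (hτ.min_const (n : ℝ≥0)) n fun ω => min_le_right _ _
    have hm : MeasurableSet {ω | τ ω ≤ (n : ℝ≥0)} := hτ.measurableSpace_le _ (hτ.measurableSet_le' _)
    refine ⟨hi.indicator hm, ?_⟩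
    refine (condExp_indicator hi (hτ.measurableSet_le' _)).trans ?_
    have h1 := condExp_min_stopping_time_ae_eq_restrict_le_const (μ := P)
      (f := stoppedValue Z fun ω => min (τ ω) (n : ℝ≥0)) hτ (n : ℝ≥0)
    rw [EventuallyEq, ae_restrict_iff' hm] at h1
    filter_upwards [h1, he] with ω e1 e2
    by_cases hω : ω ∈ {ω | τ ω ≤ (n : ℝ≥0)}
    · simp only [indicator_of_mem hω]
      rw [← e1 hω, e2]
    · simp only [indicator_of_notMem hω]

/-! ### Optional projection of an absolutely continuous process. -/

section Projection

variable [IsProbabilityMeasure P] {k H B : ℝ≥0 → Ω → ℝ}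

lemma ae_optionalProjection_eq_condExp
    (hki : ∀ t, Integrable (Function.uncurry k) ((leb.restrict (Ioc 0 t)).prod P))
    (hH : IsOptionalProjection F P k H) (t : ℝ≥0) :
    ∀ᵐ u ∂leb.restrict (Ioc 0 t), Integrable (k u) P ∧ H u =ᵐ[P] P[k u | F u] := by
  filter_upwards [(hki t).prod_right_ae] with u hu using ⟨hu, hH.ae_eq_condExp hu⟩

/-- Conditional Jensen at almost every time: E|H_u| ≤ E|k_u|, and the right side is integrable in u.
-/
lemma integrable_optionalProjection
    (hki : ∀ t, Integrable (Function.uncurry k) ((leb.restrict (Ioc 0 t)).prod P))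
    (hH : IsOptionalProjection F P k H) (t : ℝ≥0) :
    Integrable (Function.uncurry H) ((leb.restrict (Ioc 0 t)).prod P) := by
  have hm := measurable_uncurry_of_progressive hH.isStronglyProgressive
  rw [integrable_prod_iff hm.aestronglyMeasurable]
  refine ⟨?_, ?_⟩
  · filter_upwards [ae_optionalProjection_eq_condExp hki hH t] with u hu
    exact integrable_condExp.congr hu.2.symm
  · refine Integrable.mono' (hki t).integral_norm_prod_left
      hm.norm.stronglyMeasurable.integral_prod_right'.aestronglyMeasurable ?_
    filter_upwards [ae_optionalProjection_eq_condExp hki hH t] with u hu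
    rw [Real.norm_of_nonneg (by positivity)]
    refine le_trans (le_of_eq (integral_congr_ae ?_)) (integral_abs_condExp_le (m := F u) (k u))
    filter_upwards [hu.2] with ω hω
    simp [Function.uncurry, hω]

/-- The optional projection of an absolutely continuous process with integrable derivative is the
sum of a càdlàg martingale and of the integral of the optional projection of the derivative. -/
theorem exists_optionalProjection_of_drift (hF : UsualConditions F P) (hFG : F ≤ G)
    (hk : IsStronglyProgressive G k)
    (hki : ∀ t, Integrable (Function.uncurry k) ((leb.restrict (Ioc 0 t)).prod P))
    (hBp : IsStronglyProgressive G B)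
    (hB : ∀ᵐ ω ∂P, ∀ t, B t ω = ∫ u in Ioc 0 t, k u ω ∂leb)
    (hH : IsOptionalProjection F P k H) :
    ∃ Y M : ℝ≥0 → Ω → ℝ, IsOptionalProjection F P B Y ∧ Martingale M F P ∧
      (∀ ω, IsCadlag fun t => M t ω) ∧ (∀ᵐ ω ∂P, ∀ t, subIntegral Y H t ω = M t ω) ∧
      (Immersed F G P → ∀ᵐ ω ∂P, ∀ t, M t ω = 0) := by
  classical
  have hHp := hH.isStronglyProgressive
  have hHi := integrable_optionalProjection hki hH
  set good : Set Ω := {ω | ∀ t, IntegrableOn (fun u => H u ω) (Ioc 0 t) leb} with hgood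
  have hae : ∀ᵐ ω ∂P, ω ∈ good := ae_integrableOn_paths hHi
  -- Set to zero off `good`, so that every path is continuous and not merely almost every one.
  set I : ℝ≥0 → Ω → ℝ := fun t => good.indicator fun ω => ∫ u in Ioc 0 t, H u ω ∂leb with hI
  have hIa : StronglyAdapted F I := fun t =>
    (stronglyMeasurable_setIntegral_of_progressive hHp t).indicator (hF.measurableSet_of_ae hae t)
  have hIc : ∀ ω, Continuous fun t => I t ω := by
    intro ω
    by_cases hω : ω ∈ good
    · simp only [hI, indicator_of_mem hω]
      exact continuous_primitive_leb hω
    · simp only [hI, indicator_of_notMem hω]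
      exact continuous_const
  have hIp : IsStronglyProgressive F I := hIa.isStronglyProgressive_of_continuous hIc
  have hIpG : IsStronglyProgressive G I :=
    StronglyAdapted.isStronglyProgressive_of_continuous (fun t => (hIa t).mono (hFG t)) hIc
  have hIe : ∀ᵐ ω ∂P, ∀ t, I t ω = ∫ u in Ioc 0 t, H u ω ∂leb := by
    filter_upwards [hae] with ω hω t
    simp only [hI, indicator_of_mem hω]
  set J : ℝ≥0 → Ω → ℝ := fun u ω => k u ω - H u ω with hJdef
  set D : ℝ≥0 → Ω → ℝ := fun t ω => B t ω - I t ω with hDdef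
  have hJ : ∀ t, Integrable (Function.uncurry J) ((leb.restrict (Ioc 0 t)).prod P) :=
    fun t => (hki t).sub (hHi t)
  have hDp : IsStronglyProgressive G D := hBp.sub hIpG
  have hD : ∀ᵐ ω ∂P, ∀ t, D t ω = ∫ u in Ioc 0 t, J u ω ∂leb := by
    filter_upwards [hB, hIe, ae_integrableOn_paths hki, ae_integrableOn_paths hHi]
      with ω h1 h2 h3 h4 t
    simp only [hDdef, hJdef, h1, h2]
    rw [integral_sub (h3 t) (h4 t)]
  have hJ0 : ∀ t, ∀ᵐ u ∂leb.restrict (Ioc 0 t), P[J u | F u] =ᵐ[P] 0 := by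
    intro t
    filter_upwards [ae_optionalProjection_eq_condExp hki hH t] with u ⟨hu, hHu⟩
    have hHui : Integrable (H u) P := integrable_condExp.congr hHu.symm
    have h1 : P[H u | F u] = H u :=
      condExp_of_stronglyMeasurable (F.le u) (hHp.stronglyAdapted u) hHui
    have h2 : P[J u | F u] =ᵐ[P] P[k u | F u] - P[H u | F u] := condExp_sub hu hHui (F u)
    rw [h1] at h2
    filter_upwards [h2, hHu] with ω e1 e2
    rw [e1, Pi.sub_apply, e2, sub_self, Pi.zero_apply]
  have hM0 : Martingale (fun t => P[D t | F t]) F P := by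
    refine ⟨fun t => stronglyMeasurable_condExp, fun s t hst => ?_⟩
    refine (condExp_condExp_of_le (F.mono hst) (F.le t)).trans ?_
    have h := condExp_stoppedValue_of_drift hFG hJ hD hDp hJ0 (isStoppingTime_const F s)
      (N := t) fun _ => WithTop.coe_le_coe.2 hst
    rwa [IsStoppingTime.measurableSpace_const, stoppedValue_const] at h
  obtain ⟨M, hMa, hMc, hMm⟩ := exists_cadlag_modification hF hM0
  have hM : Martingale M F P := martingale_of_modification hM0 hMa hMm
  refine ⟨fun t ω => M t ω + I t ω, M, ?_, hM, hMc, ?_, fun himm => ?_⟩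
  · refine isOptionalProjection_of_bounded (hMa.add hIa)
      (fun ω => (hMc ω).add (isCadlag_of_continuous (hIc ω))) fun τ hτ N hN => ?_
    have hτG : IsStoppingTime G τ := fun i => hFG i _ (hτ i)
    have hBi := integrable_stoppedValue_of_drift hki hB hBp hτG hN
    have hDi := integrable_stoppedValue_of_drift hJ hD hDp hτG hN
    refine ⟨hBi, ?_⟩
    have hIi : Integrable (stoppedValue I τ) P := by
      have : stoppedValue I τ = stoppedValue B τ - stoppedValue D τ := by
        ext ω
        simp [stoppedValue, hDdef]
      rw [this]
      exact hBi.sub hDi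
    have e1 : P[stoppedValue I τ | hτ.measurableSpace] = stoppedValue I τ :=
      condExp_of_stronglyMeasurable hτ.measurableSpace_le
        (measurable_stoppedValue hIp hτ).stronglyMeasurable hIi
    have e2 : stoppedValue B τ = stoppedValue D τ + stoppedValue I τ := by
      ext ω
      simp [stoppedValue, hDdef]
    -- M_τ = E(M_N | F_τ) = E(D_N | F_τ) = E(D_τ | F_τ): optional sampling, the tower property, then
    -- the vanishing drift.
    have e3 : stoppedValue M τ =ᵐ[P] P[stoppedValue D τ | hτ.measurableSpace] :=
      (stoppedValue_ae_eq_condExp_of_cadlag hM hMc hτ hN).2.trans <|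
        (condExp_congr_ae (hMm N)).trans <|
        (condExp_condExp_of_le (hτ.measurableSpace_le_of_le_const hN) (F.le N)).trans <|
        condExp_stoppedValue_of_drift hFG hJ hD hDp hJ0 hτ hN
    have e4 := condExp_add hDi hIi hτ.measurableSpace
    rw [← e2, e1] at e4
    filter_upwards [e3, e4] with ω h3 h4
    rw [h4, Pi.add_apply, ← h3]
    rfl
  · filter_upwards [hIe] with ω hω t
    simp [subIntegral, hω]
  · refine ae_forall_eq_zero_of_cadlag hMc fun t => (hMm t).trans ?_
    refine condExp_eq_zero_of_drift hJ hD hDp fun s hs => ?_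
    filter_upwards [ae_optionalProjection_eq_condExp hki hH t, ae_restrict_mem measurableSet_Ioc]
      with u ⟨hu, hHu⟩ hut
    have hHui : Integrable (H u) P := integrable_condExp.congr hHu.symm
    simp only [hJdef]
    rw [integral_sub hu.integrableOn hHui.integrableOn,
      himm.setIntegral_condExp hut.2 hu (hk.stronglyAdapted u) hs,
      integral_congr_ae (ae_restrict_of_ae hHu), sub_self]

end Projection

/-! ### Independence of versions, and the density of the characteristic. -/

/-- The integrals of two versions of an optional projection are indistinguishable. -/
lemma ae_setIntegral_eq_of_optionalProjection [IsProbabilityMeasure P] {k H H' : ℝ≥0 → Ω → ℝ}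
    (hH : IsOptionalProjection F P k H) (hH' : IsOptionalProjection F P k H') :
    ∀ᵐ ω ∂P, ∀ t, ∫ u in Ioc 0 t, H u ω ∂leb = ∫ u in Ioc 0 t, H' u ω ∂leb := by
  have hm := measurable_uncurry_of_progressive hH.isStronglyProgressive
  have hm' := measurable_uncurry_of_progressive hH'.isStronglyProgressive
  have h : ∀ n : ℕ, ∀ᵐ ω ∂P, ∀ᵐ u ∂leb.restrict (Ioc 0 (n : ℝ≥0)), H u ω = H' u ω := by
    intro n
    refine (Measure.ae_ae_comm (μ := leb.restrict (Ioc 0 (n : ℝ≥0))) (ν := P)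
      (p := fun u ω => H u ω = H' u ω) (measurableSet_eq_fun hm hm')).1 ?_
    -- Agreement holds at every fixed u even if k_u is only σ-integrable; Fubini turns it into
    -- agreement for almost every u along almost every path.
    exact Eventually.of_forall fun u => (hH.isCondExp u).ae_unique (hH'.isCondExp u)
  filter_upwards [ae_all_iff.2 h] with ω hω t
  obtain ⟨n, hn⟩ := exists_nat_ge t
  exact integral_congr_ae (ae_restrict_of_ae_restrict_of_subset (Ioc_subset_Ioc_right hn) (hω n))

lemma valueAt_congr_of_ae {Z Y : ℝ≥0 → Ω → ℝ} (h : ∀ᵐ ω ∂P, ∀ t, Z t ω = Y t ω)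
    (τ : Ω → WithTop ℝ≥0) : valueAt Z τ =ᵐ[P] valueAt Y τ := by
  filter_upwards [h] with ω hω
  simp only [valueAt, indicator, stoppedValue, hω]

lemma HasDifferential.isStronglyProgressive_mul {B A b a : ℝ≥0 → Ω → ℝ}
    (h : HasDifferential G P B A b a) : IsStronglyProgressive G fun t ω => b t ω * a t ω :=
  h.predictable_b.isStronglyProgressive.mul h.progressive_a

lemma HasDifferential.ae_eq_setIntegral {B A b a : ℝ≥0 → Ω → ℝ} (h : HasDifferential G P B A b a) :
    ∀ᵐ ω ∂P, ∀ t, B t ω = ∫ u in Ioc 0 t, b u ω * a u ω ∂leb := by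
  have ham := measurable_uncurry_of_progressive h.progressive_a
  filter_upwards [h.A_eq, h.B_eq] with ω hA hB t
  exact hB.eq_setIntegral (a := fun u => a u ω) (fun u => h.nonneg_a u ω)
    (ham.comp measurable_prodMk_right) (fun t => (hA t).1) (fun t => (hA t).2) t

lemma HasDifferential.integrable_mul [IsProbabilityMeasure P] {B A b a : ℝ≥0 → Ω → ℝ}
    (h : HasDifferential G P B A b a) {t : ℝ≥0}
    (ht : ∫⁻ ω, ∫⁻ u in Ioc 0 t, ENNReal.ofReal (|b u ω| * a u ω) ∂leb ∂P < ∞) :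
    Integrable (Function.uncurry fun t ω => b t ω * a t ω) ((leb.restrict (Ioc 0 t)).prod P) := by
  have hm := measurable_uncurry_of_progressive h.isStronglyProgressive_mul
  refine ⟨hm.aestronglyMeasurable, ?_⟩
  rw [HasFiniteIntegral, lintegral_prod_symm _ hm.enorm.aemeasurable]
  refine lt_of_eq_of_lt ?_ ht
  refine lintegral_congr fun ω => lintegral_congr fun u => ?_
  rw [Function.uncurry_apply_pair, ← ofReal_norm, norm_mul, Real.norm_eq_abs,
    Real.norm_of_nonneg (h.nonneg_a u ω)]

lemma subIntegral_stronglyAdapted {Y H : ℝ≥0 → Ω → ℝ} (hY : IsStronglyProgressive F Y)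
    (hH : IsStronglyProgressive F H) : StronglyAdapted F (subIntegral Y H) := fun t =>
  (hY.stronglyAdapted t).sub (stronglyMeasurable_setIntegral_of_progressive hH t)

end Shrinkage

theorem lemma3p2 {Ω : Type*} {mΩ : MeasurableSpace Ω} (P : Measure Ω) [IsProbabilityMeasure P]
    (F G : Filtration ℝ≥0 mΩ) (hF : UsualConditions F P) (hG : UsualConditions G P) (hFG : F ≤ G)
    (X B A b a : ℝ≥0 → Ω → ℝ)
    (hX : IsSemimartingale G P X) (hB : IsFirstCharacteristic G P X B)
    (hdiff : HasDifferential G P B A b a)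
    (A1 : ∀ t : ℝ≥0, ∫⁻ ω, ∫⁻ u in Ioc 0 t, ENNReal.ofReal (|b u ω| * a u ω) ∂leb ∂P < ∞)
    (A2 : ∃ H, IsOptionalProjection F P (fun t ω => b t ω * a t ω) H) :
    ∃ Y, IsOptionalProjection F P B Y ∧
      ∀ H, IsOptionalProjection F P (fun t ω => b t ω * a t ω) H →
        (∀ᵐ ω ∂P, ∀ t, IntegrableOn (fun u => H u ω) (Ioc 0 t) leb) ∧
        Martingale (subIntegral Y H) F P ∧
        (∀ᵐ ω ∂P, IsCadlag fun t => subIntegral Y H t ω) ∧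
        (Immersed F G P → ∀ᵐ ω ∂P, ∀ t, subIntegral Y H t ω = 0) ∧
        ∀ Y', IsOptionalProjection F P B Y' →
          Martingale (subIntegral Y' H) F P ∧
          (Immersed F G P → ∀ τ, IsStoppingTime F τ →
            valueAt (subIntegral Y' H) τ =ᵐ[P] 0) := by
  have hki := fun t => hdiff.integrable_mul (A1 t)
  -- `Y` has to be chosen before `H`, so it is built from one fixed version and the others are
  -- compared with it.
  obtain ⟨H₀, hH₀⟩ := A2
  obtain ⟨Y, M, hY, hM, hMc, hYM, hM0⟩ := exists_optionalProjection_of_drift hF hFG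
    hdiff.isStronglyProgressive_mul hki hB.predictable.isStronglyProgressive
    hdiff.ae_eq_setIntegral hH₀
  refine ⟨Y, hY, fun H hH => ?_⟩
  have hHp := hH.isStronglyProgressive
  have hsub : ∀ᵐ ω ∂P, ∀ t, subIntegral Y H t ω = M t ω := by
    filter_upwards [hYM, ae_setIntegral_eq_of_optionalProjection hH hH₀] with ω h1 h2 t
    rw [← h1 t, subIntegral, subIntegral, h2 t]
  have hsub_t : ∀ t, subIntegral Y H t =ᵐ[P] M t := fun t => hsub.mono fun ω hω => hω t
  have hzero : Immersed F G P → ∀ᵐ ω ∂P, ∀ t, subIntegral Y H t ω = 0 := fun himm => by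
    filter_upwards [hsub, hM0 himm] with ω h1 h2 t
    rw [h1, h2]
  refine ⟨ae_integrableOn_paths (integrable_optionalProjection hki hH), ?_, ?_, hzero,
    fun Y' hY' => ⟨?_, fun himm τ hτ => ?_⟩⟩
  · exact martingale_of_modification hM
      (subIntegral_stronglyAdapted hY.isStronglyProgressive hHp) hsub_t
  · filter_upwards [hsub] with ω hω
    simpa only [hω] using hMc ω
  · refine martingale_of_modification hM
      (subIntegral_stronglyAdapted hY'.isStronglyProgressive hHp) fun t => ?_
    filter_upwards [hsub_t t, (hY'.isCondExp t).ae_unique (hY.isCondExp t)] with ω h1 h2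
    rw [← h1, subIntegral, subIntegral, h2]
  -- `Y'` and `Y` are compared at τ itself, through uniqueness of the conditional expectation given
  -- F_τ; no path regularity of `Y'` is required.
  · have h1 := valueAt_congr_of_ae (Y := 0) (hzero himm) τ
    filter_upwards [h1, (hY'.condExp_eq τ hτ).ae_unique (hY.condExp_eq τ hτ)] with ω h1 h2
    by_cases hω : ω ∈ {ω | τ ω < ⊤}
    · simp only [valueAt, indicator_of_mem hω, stoppedValue, subIntegral, Pi.zero_apply] at h1 h2 ⊢
      rw [h2, h1]
    · simp only [valueAt, indicator_of_notMem hω, Pi.zero_apply]
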